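/- Let $n\ge 3$ with $n\ne 4$, let $D_n=\langle x,t\mid x^n=t^2=1,\ xt=tx^{-1}\rangle$ be the dihedral group of order $2n$, and let $B=\mathrm{Perm}(D_n)$. For a finite group $G$ let $\lambda(G)\le \mathrm{Perm}(G)$ be its left regular representation and let $\mathrm{Hol}(G)=\mathrm{Norm}_{\mathrm{Perm}(G)}(\lambda(G))$. Let $\mathcal S(G)$ be the set of regular subgroups $N\cong G$ of $\mathrm{Perm}(G)$ with $N\le \mathrm{Hol}(G)$, let $\mathcal R(G)$ be the set of regular subgroups $N\cong G$ of $\mathrm{Perm}(G)$ that are normalized by $\lambda(G)$, and let $\mathcal Q(G)$ be the set of those $M\in\mathcal S(G)\cap\mathcal R(G)$ that are normalized by every $N\in\mathcal S(G)\cap\mathcal R(G)$. A set $A\subseteq \mathrm{Perm}(G)$ parameterizes a set $\mathcal X$ of conjugates of $\lambda(G)$ if $\beta\mapsto\beta\lambda(G)\beta^{-1}$ is a bijection from $A$ onto $\mathcal X$ (that is, $A$ is a set of representatives of the left cosets $\beta\,\mathrm{Hol}(G)$ with $\beta\lambda(G)\beta^{-1}\in\mathcal X$). The quasi-holomorph is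 $\mathrm{QHol}(G)=\bigcup_{\beta\in A}\beta\,\mathrm{Hol}(G)$, for any $A$ that parameterizes $\mathcal Q(G)$. Let $\Upsilon_n=\{u\in(\mathbb Z/n)^\times: u^2=1\}$, let $\tau_u\in B$ be given by $\tau_u(x^i)=x^i$, $\tau_u(tx^i)=tx^{ui}$, and let $M_n=\{\tau_u: u\in\Upsilon_n\}$. Then there is a subgroup $P\le B$ that is an elementary abelian $2$-group and parameterizes $\mathcal Q(D_n)$. More precisely: 1. If $8\nmid n$, one can take $P=M_n$. 2. If $8\mid n$, the map $\theta(t^ax^c)=t^ax^{c+\lceil c/2\rceil n/2}$ (for $a\in\{0,1\}$, $0\le c<n$) is a permutation of $D_n$ of order $2$, the set $M_n\cup\theta M_n$ parameterizes $\mathcal Q(D_n)$, and one can take $P=P_0\cup\theta P_0$, of order $2|M_n|$, for some subgroup $P_0\le B$ with $\theta\notin P_0$ that parameterizes the same conjugates of $\lambda(D_n)$ as $M_n$, namely $\{\tau_u\lambda(D_n)\tau_u^{-1}:u\in\Upsilon_n\}$. Consequently $\mathrm{QHol}(D_n)$ (which does not depend on the choice of parameterizing set) is a subgroup of $B$, and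 it is the Zappa–Szép product of $P$ and $\mathrm{Hol}(D_n)$: both are subgroups of it, $\mathrm{QHol}(D_n)=P\cdot\mathrm{Hol}(D_n)$ and $P\cap\mathrm{Hol}(D_n)=1$. -/

import Mathlib

open scoped Pointwise

/-- The left regular representation `λ(G)`, as a subgroup of `Perm(G)`. -/
def leftReg (G : Type*) [Group G] : Subgroup (Equiv.Perm G) :=
  (MulAction.toPermHom G G).range

/-- `Norm_B(N)` for a subgroup `N` of a group `B`. -/
def normOf {B : Type*} [Group B] (N : Subgroup B) : Subgroup B :=
  Subgroup.normalizer (N : Set B)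

/-- The holomorph `Hol(G)`: the normalizer of `λ(G)` in `Perm(G)`. -/
def hol (G : Type*) [Group G] : Subgroup (Equiv.Perm G) :=
  normOf (leftReg G)

/-- A permutation group is regular if for all points `x, y` it has exactly one element taking
`x` to `y` (i.e. it is transitive with trivial point stabilizers). -/
def IsRegularPerm {X : Type*} (N : Subgroup (Equiv.Perm X)) : Prop :=
  ∀ x y : X, ∃! g : Equiv.Perm X, g ∈ N ∧ g x = y

/-- `𝓢(G)`: the regular subgroups of `Perm(G)` that are isomorphic to `G` and contained in
`Hol(G)`. -/
def classS (G : Type*) [Group G] : Set (Subgroup (Equiv.Perm G)) :=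
  {N | IsRegularPerm N ∧ Nonempty (N ≃* G) ∧ N ≤ hol G}

/-- `𝓡(G)`: the regular subgroups of `Perm(G)` that are isomorphic to `G` and normalized by
`λ(G)`. -/
def classR (G : Type*) [Group G] : Set (Subgroup (Equiv.Perm G)) :=
  {N | IsRegularPerm N ∧ Nonempty (N ≃* G) ∧ leftReg G ≤ normOf N}

/-- `𝓠(G)`: the members of `𝓢(G) ∩ 𝓡(G)` that are normalized by every member of
`𝓢(G) ∩ 𝓡(G)`. -/
def classQ (G : Type*) [Group G] : Set (Subgroup (Equiv.Perm G)) :=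
  {M | M ∈ classS G ∩ classR G ∧ ∀ N ∈ classS G ∩ classR G, N ≤ normOf M}

/-- The conjugate `β λ(G) β⁻¹`. -/
def conjLeftReg {G : Type*} [Group G] (β : Equiv.Perm G) : Subgroup (Equiv.Perm G) :=
  (leftReg G).map (MulAut.conj β).toMonoidHom

/-- `A` is a `π(𝓧)`: `β ↦ β λ(G) β⁻¹` is a bijection from `A` onto `𝓧`. As `Hol(G)` is the
stabilizer of `λ(G)` under conjugation, this says that the elements of `A` lie in distinct left
cosets of `Hol(G)` and that these cosets are the ones that correspond to the members of `𝓧`. -/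
def Parameterizes {G : Type*} [Group G] (A : Set (Equiv.Perm G))
    (𝓧 : Set (Subgroup (Equiv.Perm G))) : Prop :=
  Set.BijOn conjLeftReg A 𝓧

/-- `⋃ β Hol(G)`, over `β ∈ A`; for `A = π(𝓠(G))` it is the quasi-holomorph `QHol(G)`. -/
def holCosets {G : Type*} [Group G] (A : Set (Equiv.Perm G)) : Set (Equiv.Perm G) :=
  A * (hol G : Set (Equiv.Perm G))

/-- `K` is the (internal) Zappa–Szép product of its subgroups `P` and `H`. -/
def IsZappaSzep {B : Type*} [Group B] (K P H : Subgroup B) : Prop :=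
  P ≤ K ∧ H ≤ K ∧ (P : Set B) * (H : Set B) = (K : Set B) ∧ P ⊓ H = ⊥

/-- `P` is an elementary abelian `2`-group. -/
def IsElementaryAbelianTwo {B : Type*} [Group B] (P : Subgroup B) : Prop :=
  (∀ a ∈ P, ∀ b ∈ P, a * b = b * a) ∧ ∀ a ∈ P, a ^ 2 = 1

/-- For a unit `u` of `ℤ/n`, the permutation `τ_u` of `D_n`: `x ^ i ↦ x ^ i` and
`t x ^ i ↦ t x ^ (u i)`. Here `x ^ i` is `r i` and `t x ^ i` is `sr i`. -/
def tau (n : ℕ) (u : (ZMod n)ˣ) : Equiv.Perm (DihedralGroup n) where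
  toFun
    | .r i => .r i
    | .sr i => .sr (u * i)
  invFun
    | .r i => .r i
    | .sr i => .sr ((u⁻¹ : (ZMod n)ˣ) * i)
  left_inv := by rintro (i | i) <;> simp
  right_inv := by rintro (i | i) <;> simp

/-- `Υ_n`: the units `u` of `ℤ/n` with `u² = 1`. -/
def Upsilon (n : ℕ) : Set (ZMod n)ˣ := {u | u ^ 2 = 1}

/-- `M_n = {τ_u | u ∈ Υ_n}`. -/
def tauSet (n : ℕ) : Set (Equiv.Perm (DihedralGroup n)) := tau n '' Upsilon n

/-- The map `c ↦ c + ⌈c/2⌉ (n/2)` on `ℤ/n`, with `c` represented in `{0, …, n - 1}`. -/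
def thetaExp (n : ℕ) (c : ZMod n) : ZMod n :=
  c + (((c.val + 1) / 2 * (n / 2) : ℕ) : ZMod n)

/-- The map `t ^ a x ^ c ↦ t ^ a x ^ (c + ⌈c/2⌉ (n/2))` on `D_n`. -/
def thetaFun (n : ℕ) : DihedralGroup n → DihedralGroup n
  | .r c => .r (thetaExp n c)
  | .sr c => .sr (thetaExp n c)

/-! For `n ≥ 3`, `Hol(D_n)` consists of the maps that preserve or exchange the blocks `{x^i}`, `{t
x^i}` and are affine on both with one common multiplier. For `u² = 1`, conjugation by `τ_u`
preserves this form. Hence `τ_u λ τ_u⁻¹` lies in `Hol(D_n)` and is normalized by all of it, so it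
belongs to `𝓠(D_n)`.

Conversely, let `M ∈ 𝓠(D_n)` and let `h` shift one block and fix the other. Then `h M h⁻¹` is again
in `𝓠(D_n)` and normalizes `M`. If `g ∈ M` preserves the blocks with multiplier `s`, the commutator
of `h g h⁻¹` and `g` lies in `M` and has a fixed point, so it is trivial by regularity; this says
`(1 - s)² = 0` (`one_sub_sq_eq_zero_of_mem_classQ`). As `n ≠ 4`, a rotation generating the cyclic
part of `M` can be taken to preserve the blocks. Its multiplier `w` has `w² = 1`, so `2 (w - 1) =
0`. If `w = 1`, then `M = τ_u λ τ_u⁻¹` (`eq_conjLeftReg_tau`); otherwise `w = 1 + n/2`, which forces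
`8 ∣ n`.

For `8 ∣ n`, `θ` adds `n/2` times the parity of `c (c + 1) / 2`. This term is quadratic, so `θ`
conjugates affine maps of `ℤ/n` to affine maps and changes the multiplier by a multiple of `n/2`
(`thetaExp_affine`). The multipliers `1` and `1 + n/2` of rotations are thereby interchanged, which
reduces the second case to the first. Members of `𝓢(D_n)` have translation parts of equal parity on
the two blocks (`isEvenAffine_of_mem_classS`), and such maps are stable under `θ`; this puts the
groups conjugated by `θ τ_u` into `𝓠(D_n)`.

For `P`: `θ` commutes with `τ_u` when `u ≡ 1` modulo `4`. When `u ≡ -1`, `τ_u` is replaced by `ρ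
τ_{-u}`, where `ρ = rotationReflection n` commutes with `θ`; the coset of `Hol(D_n)` is unchanged.
The product statement holds for any subgroup that parameterizes `𝓠(G)`, since `𝓠(G)` is stable under
`Hol(G)` (`exists_isZappaSzep`). -/

/-! ### Conjugates of `λ(G)` and the quasi-holomorph of a general group. -/

section General

variable {G : Type*} [Group G]

/-- The conjugate `h N h⁻¹` of a subgroup. -/
def conjSubgroup {B : Type*} [Group B] (h : B) (N : Subgroup B) : Subgroup B :=
  N.map (MulAut.conj h).toMonoidHom

theorem mem_conjSubgroup {B : Type*} [Group B] {h : B} {N : Subgroup B} {x : B} :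
    x ∈ conjSubgroup h N ↔ h⁻¹ * x * h ∈ N := by
  constructor
  · rintro ⟨y, hy, rfl⟩
    have : h⁻¹ * ((MulAut.conj h).toMonoidHom y) * h = y := by
      simp [mul_assoc]
    rw [this]; exact hy
  · intro hx
    exact ⟨_, hx, by simp [mul_assoc]⟩

theorem conjSubgroup_mul {B : Type*} [Group B] (a b : B) (N : Subgroup B) :
    conjSubgroup (a * b) N = conjSubgroup a (conjSubgroup b N) := by
  ext x
  simp [mem_conjSubgroup, mul_assoc]

theorem conjSubgroup_one {B : Type*} [Group B] (N : Subgroup B) :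
    conjSubgroup 1 N = N := by
  ext x
  simp [mem_conjSubgroup]

theorem conjSubgroup_injective {B : Type*} [Group B] (a : B) :
    Function.Injective (conjSubgroup a) := by
  intro M N h
  have := congrArg (conjSubgroup a⁻¹) h
  simpa [← conjSubgroup_mul, conjSubgroup_one] using this

theorem conjSubgroup_inv_conjSubgroup {B : Type*} [Group B] (a : B) (N : Subgroup B) :
    conjSubgroup a⁻¹ (conjSubgroup a N) = N := by
  simp [← conjSubgroup_mul, conjSubgroup_one]

theorem conjSubgroup_conjSubgroup_inv {B : Type*} [Group B] (a : B) (N : Subgroup B) :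
    conjSubgroup a (conjSubgroup a⁻¹ N) = N := by
  simp [← conjSubgroup_mul, conjSubgroup_one]

theorem mem_normOf_iff {B : Type*} [Group B] {h : B} {N : Subgroup B} :
    h ∈ normOf N ↔ conjSubgroup h N = N := by
  rw [normOf, Subgroup.mem_normalizer_iff]
  constructor
  · intro H
    ext x
    rw [mem_conjSubgroup, H]
    simp [mul_assoc]
  · intro H x
    have := mem_conjSubgroup (h := h) (N := N) (x := h * x * h⁻¹)
    rw [H] at this
    simpa [mul_assoc] using this.symm

theorem mem_normOf_conjSubgroup {B : Type*} [Group B] {a h : B} {N : Subgroup B} :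
    h ∈ normOf (conjSubgroup a N) ↔ a⁻¹ * h * a ∈ normOf N := by
  rw [mem_normOf_iff, mem_normOf_iff, ← conjSubgroup_mul]
  constructor
  · intro H
    rw [mul_assoc, conjSubgroup_mul, H, conjSubgroup_inv_conjSubgroup]
  · intro H
    apply conjSubgroup_injective a⁻¹
    rw [← conjSubgroup_mul, ← mul_assoc, H, conjSubgroup_inv_conjSubgroup]

theorem conjLeftReg_eq (β : Equiv.Perm G) : conjLeftReg β = conjSubgroup β (leftReg G) := rfl

theorem conjLeftReg_mul (a b : Equiv.Perm G) :
    conjLeftReg (a * b) = conjSubgroup a (conjLeftReg b) :=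
  conjSubgroup_mul a b _

theorem conjLeftReg_one : conjLeftReg (1 : Equiv.Perm G) = leftReg G :=
  conjSubgroup_one _

theorem mem_leftReg {g : Equiv.Perm G} : g ∈ leftReg G ↔ ∃ d : G, ∀ y, g y = d * y := by
  constructor
  · rintro ⟨d, rfl⟩
    exact ⟨d, fun y => rfl⟩
  · rintro ⟨d, hd⟩
    exact ⟨d, Equiv.ext fun y => (hd y).symm⟩

theorem mem_conjLeftReg {β g : Equiv.Perm G} :
    g ∈ conjLeftReg β ↔ ∃ d : G, ∀ y, g (β y) = β (d * y) := by
  rw [conjLeftReg_eq, mem_conjSubgroup, mem_leftReg]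
  simp only [Equiv.Perm.mul_apply, Equiv.Perm.inv_eq_iff_eq]

theorem mem_hol_iff {h : Equiv.Perm G} : h ∈ hol G ↔ conjLeftReg h = leftReg G :=
  mem_normOf_iff

theorem conjLeftReg_eq_conjLeftReg_iff {a b : Equiv.Perm G} :
    conjLeftReg a = conjLeftReg b ↔ a⁻¹ * b ∈ hol G := by
  rw [mem_hol_iff, conjLeftReg_mul]
  constructor
  · intro H
    rw [← H, conjLeftReg_eq, conjSubgroup_inv_conjSubgroup]
  · intro H
    rw [conjLeftReg_eq, ← H, conjSubgroup_conjSubgroup_inv]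

/-- This turns every normalization condition in `𝓠(G)` into a membership test in `Hol(G)`. -/
theorem mem_normOf_conjLeftReg {a h : Equiv.Perm G} :
    h ∈ normOf (conjLeftReg a) ↔ a⁻¹ * h * a ∈ hol G :=
  mem_normOf_conjSubgroup

theorem IsRegularPerm.conjSubgroup {X : Type*} {N : Subgroup (Equiv.Perm X)}
    (hN : IsRegularPerm N) (h : Equiv.Perm X) : IsRegularPerm (conjSubgroup h N) := by
  intro x y
  obtain ⟨g, ⟨hg, hgx⟩, hu⟩ := hN (h⁻¹ x) (h⁻¹ y)
  refine ⟨h * g * h⁻¹, ⟨mem_conjSubgroup.2 (by simpa [mul_assoc] using hg), ?_⟩, ?_⟩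
  · rw [Equiv.Perm.mul_apply, Equiv.Perm.mul_apply, hgx, ← Equiv.Perm.mul_apply, mul_inv_cancel,
      Equiv.Perm.one_apply]
  · rintro k ⟨hk, hkx⟩
    have := hu (h⁻¹ * k * h) ⟨mem_conjSubgroup.1 hk, by simp [hkx]⟩
    rw [← this]; group

theorem nonempty_mulEquiv_conjSubgroup {B : Type*} [Group B] {N : Subgroup B} {H : Type*} [Group H]
    (e : Nonempty (N ≃* H)) (h : B) : Nonempty ((conjSubgroup h N : Subgroup B) ≃* H) := by
  obtain ⟨e⟩ := e
  exact ⟨(N.equivMapOfInjective _ (MulAut.conj h).injective).symm.trans e⟩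

theorem IsRegularPerm.eq_of_le {X : Type*} [Nonempty X] {M N : Subgroup (Equiv.Perm X)}
    (hM : IsRegularPerm M) (hN : IsRegularPerm N) (h : M ≤ N) : M = N := by
  refine le_antisymm h fun g hg => ?_
  obtain ⟨x⟩ := ‹Nonempty X›
  obtain ⟨m, ⟨hm, hmx⟩, -⟩ := hM x (g x)
  rwa [(hN x (g x)).unique ⟨hg, rfl⟩ ⟨h hm, hmx⟩]

theorem IsRegularPerm.eq_one {X : Type*} {N : Subgroup (Equiv.Perm X)}
    (hN : IsRegularPerm N) {g : Equiv.Perm X} (hg : g ∈ N) {x : X} (hx : g x = x) : g = 1 :=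
  (hN x x).unique ⟨hg, hx⟩ ⟨N.one_mem, rfl⟩

theorem isRegularPerm_leftReg : IsRegularPerm (leftReg G) := by
  intro x y
  refine ⟨MulAction.toPermHom G G (y * x⁻¹), ⟨⟨_, rfl⟩, by simp⟩, ?_⟩
  rintro g ⟨⟨d, rfl⟩, hd⟩
  have : d * x = y := hd
  simp [← this]

theorem nonempty_leftReg_mulEquiv : Nonempty (leftReg G ≃* G) :=
  ⟨(MonoidHom.ofInjective (f := MulAction.toPermHom G G) MulAction.toPerm_injective).symm⟩

theorem leftReg_le_hol : leftReg G ≤ hol G := Subgroup.le_normalizer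

theorem leftReg_mem_classS : leftReg G ∈ classS G :=
  ⟨isRegularPerm_leftReg, nonempty_leftReg_mulEquiv, leftReg_le_hol⟩

theorem conjSubgroup_mem_classS {h : Equiv.Perm G} (hh : h ∈ hol G) {N : Subgroup (Equiv.Perm G)}
    (hN : N ∈ classS G) : conjSubgroup h N ∈ classS G := by
  refine ⟨hN.1.conjSubgroup h, nonempty_mulEquiv_conjSubgroup hN.2.1 h, fun x hx => ?_⟩
  have := mul_mem (mul_mem hh (hN.2.2 (mem_conjSubgroup.1 hx))) (inv_mem hh)
  simpa [mul_assoc] using this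

theorem conjSubgroup_mem_classR {h : Equiv.Perm G} (hh : h ∈ hol G) {N : Subgroup (Equiv.Perm G)}
    (hN : N ∈ classR G) : conjSubgroup h N ∈ classR G := by
  refine ⟨hN.1.conjSubgroup h, nonempty_mulEquiv_conjSubgroup hN.2.1 h, fun x hx => ?_⟩
  rw [mem_normOf_conjSubgroup]
  apply hN.2.2
  rw [← mem_conjSubgroup, ← conjLeftReg_eq, mem_hol_iff.1 hh]
  exact hx

theorem conjSubgroup_mem_classQ {h : Equiv.Perm G} (hh : h ∈ hol G) {M : Subgroup (Equiv.Perm G)}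
    (hM : M ∈ classQ G) : conjSubgroup h M ∈ classQ G := by
  refine ⟨⟨conjSubgroup_mem_classS hh hM.1.1, conjSubgroup_mem_classR hh hM.1.2⟩,
    fun N hN x hx => ?_⟩
  rw [mem_normOf_conjSubgroup]
  refine hM.2 (conjSubgroup h⁻¹ N) ⟨conjSubgroup_mem_classS (inv_mem hh) hN.1,
    conjSubgroup_mem_classR (inv_mem hh) hN.2⟩ ?_
  rw [mem_conjSubgroup]
  simpa [mul_assoc] using hx

theorem conjLeftReg_mem_classS {β : Equiv.Perm G} (h : conjLeftReg β ≤ hol G) :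
    conjLeftReg β ∈ classS G :=
  ⟨isRegularPerm_leftReg.conjSubgroup β,
    nonempty_mulEquiv_conjSubgroup nonempty_leftReg_mulEquiv β, h⟩

/-- A conjugate of `λ(G)` inside `Hol(G)` that is normalized by all of `𝓢(G)` lies in `𝓠(G)`. -/
theorem conjLeftReg_mem_classQ {β : Equiv.Perm G} (h : conjLeftReg β ≤ hol G)
    (hn : ∀ N ∈ classS G, N ≤ normOf (conjLeftReg β)) : conjLeftReg β ∈ classQ G := by
  have hS := conjLeftReg_mem_classS h
  exact ⟨⟨hS, hS.1, hS.2.1, hn _ leftReg_mem_classS⟩, fun N hN => hn N hN.1⟩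

theorem holCosets_eq {A : Set (Equiv.Perm G)} {𝓧 : Set (Subgroup (Equiv.Perm G))}
    (hA : Parameterizes A 𝓧) : holCosets A = {β | conjLeftReg β ∈ 𝓧} := by
  ext β
  constructor
  · rintro ⟨a, ha, h, hh, rfl⟩
    have : conjLeftReg (a * h) = conjLeftReg a := by
      rw [conjLeftReg_mul, mem_hol_iff.1 hh, conjLeftReg_eq]
    simpa [this] using hA.mapsTo ha
  · intro hβ
    obtain ⟨a, ha, hab⟩ := hA.surjOn hβ
    exact ⟨a, ha, a⁻¹ * β, conjLeftReg_eq_conjLeftReg_iff.1 hab, by simp⟩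

/-- A subgroup that parameterizes `𝓠(G)` makes the quasi-holomorph a Zappa–Szép product. -/
theorem exists_isZappaSzep {P : Subgroup (Equiv.Perm G)}
    (hP : Parameterizes (P : Set (Equiv.Perm G)) (classQ G)) :
    ∃ K : Subgroup (Equiv.Perm G),
      (∀ A : Set (Equiv.Perm G), Parameterizes A (classQ G) →
        holCosets A = (K : Set (Equiv.Perm G))) ∧ IsZappaSzep K P (hol G) := by
  have hQ1 : conjLeftReg (1 : Equiv.Perm G) ∈ classQ G := hP.mapsTo P.one_mem
  let K : Subgroup (Equiv.Perm G) :=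
    { carrier := {β | conjLeftReg β ∈ classQ G}
      one_mem' := hQ1
      mul_mem' := by
        intro a b ha hb
        -- With `a ∈ p Hol(G)`, the element `p⁻¹ a` moves the conjugate given by `b` within `𝓠(G)`,
        -- to that of some `q ∈ P`; so `a b` and `p q` give the same conjugate.
        obtain ⟨p, hp, hpa⟩ := hP.surjOn ha
        have h1 := conjLeftReg_eq_conjLeftReg_iff.1 hpa
        have h2 := conjSubgroup_mem_classQ h1 hb
        obtain ⟨q, hq, hqb⟩ := hP.surjOn h2
        have : conjLeftReg (a * b) = conjLeftReg (p * q) := by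
          rw [conjLeftReg_mul p q, hqb, ← conjSubgroup_mul, conjLeftReg_mul]
          simp
        change conjLeftReg (a * b) ∈ classQ G
        rw [this]
        exact hP.mapsTo (mul_mem hp hq)
      inv_mem' := by
        intro a ha
        obtain ⟨p, hp, hpa⟩ := hP.surjOn ha
        have h1 := conjLeftReg_eq_conjLeftReg_iff.1 hpa
        have h2 := conjSubgroup_mem_classQ (inv_mem h1) (hP.mapsTo (inv_mem hp))
        rw [← conjLeftReg_mul] at h2
        simpa using h2 }
  have hK : ∀ A : Set (Equiv.Perm G), Parameterizes A (classQ G) →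
      holCosets A = (K : Set (Equiv.Perm G)) := fun A hA => holCosets_eq hA
  refine ⟨K, hK, fun p hp => hP.mapsTo hp, fun h hh => ?_, hK _ hP, ?_⟩
  · change conjLeftReg h ∈ classQ G
    rwa [mem_hol_iff.1 hh, ← conjLeftReg_one]
  · rw [eq_bot_iff]
    rintro p ⟨hp, hh⟩
    refine Subgroup.mem_bot.2 (hP.injOn hp P.one_mem ?_)
    rw [mem_hol_iff.1 hh, conjLeftReg_one]

/-- A subgroup with an added commuting involution. -/
def adjoinInvolution {B : Type*} [Group B] (P : Subgroup B) (g : B) (hg : g * g = 1)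
    (hc : ∀ p ∈ P, g * p = p * g) : Subgroup B where
  carrier := (P : Set B) ∪ (fun σ => g * σ) '' (P : Set B)
  one_mem' := Or.inl P.one_mem
  mul_mem' := by
    rintro _ _ (ha | ⟨a, ha, rfl⟩) (hb | ⟨b, hb, rfl⟩)
    · exact Or.inl (mul_mem ha hb)
    · exact Or.inr ⟨_, mul_mem ha hb, by simp only [← mul_assoc]; rw [hc _ ha]⟩
    · exact Or.inr ⟨_, mul_mem ha hb, by simp only [← mul_assoc]⟩
    · refine Or.inl ?_
      have : g * a * (g * b) = a * b := by
        rw [hc a ha, mul_assoc, ← mul_assoc g g b, hg, one_mul]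
      rw [this]
      exact mul_mem ha hb
  inv_mem' := by
    rintro _ (ha | ⟨a, ha, rfl⟩)
    · exact Or.inl (inv_mem ha)
    · refine Or.inr ⟨_, inv_mem ha, ?_⟩
      have : g⁻¹ = g := inv_eq_of_mul_eq_one_left hg
      simp only [mul_inv_rev, this]
      exact hc _ (inv_mem ha)

theorem IsElementaryAbelianTwo.adjoinInvolution {B : Type*} [Group B] {P : Subgroup B}
    (hP : IsElementaryAbelianTwo P) {g : B} (hg : g * g = 1) (hc : ∀ p ∈ P, g * p = p * g) :
    IsElementaryAbelianTwo (adjoinInvolution P g hg hc) := by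
  have hgg : ∀ a ∈ P, ∀ b ∈ P, g * a * (g * b) = a * b := by
    intro a ha b hb
    rw [hc a ha, mul_assoc, ← mul_assoc g g b, hg, one_mul]
  constructor
  · rintro _ (ha | ⟨a, ha, rfl⟩) _ (hb | ⟨b, hb, rfl⟩)
    · exact hP.1 _ ha _ hb
    · simp only []
      rw [← mul_assoc, ← hc _ ha, mul_assoc, hP.1 _ ha _ hb, mul_assoc]
    · simp only []
      rw [mul_assoc, hP.1 _ ha _ hb, ← mul_assoc, ← mul_assoc, hc _ hb]
    · simp only []
      rw [hgg _ ha _ hb, hgg _ hb _ ha, hP.1 _ ha _ hb]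
  · rintro _ (ha | ⟨a, ha, rfl⟩)
    · exact hP.2 _ ha
    · simp only []
      rw [sq, hgg _ ha _ ha, ← sq, hP.2 _ ha]

end General

/-! ### The holomorph of `D_n` as a group of affine maps. -/

section Forms

open DihedralGroup

variable {n : ℕ}

/-- `g` acts on each of the blocks `{x ^ i}`, `{t x ^ i}` as an affine map with multiplier `v`. -/
def IsBlockAffine (g : Equiv.Perm (DihedralGroup n)) (v a b : ZMod n) : Prop :=
  ∀ i, g (r i) = r (v * i + a) ∧ g (sr i) = sr (v * i + b)

/-- `g` exchanges the blocks `{x ^ i}`, `{t x ^ i}` by affine maps with multiplier `v`. -/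
def IsSwapAffine (g : Equiv.Perm (DihedralGroup n)) (v a b : ZMod n) : Prop :=
  ∀ i, g (r i) = sr (v * i + a) ∧ g (sr i) = r (v * i + b)

variable {g h : Equiv.Perm (DihedralGroup n)} {v a b w c d : ZMod n}

theorem isBlockAffine_one : IsBlockAffine (1 : Equiv.Perm (DihedralGroup n)) 1 0 0 := by
  intro i; simp

theorem IsBlockAffine.ext (hg : IsBlockAffine g v a b) (hh : IsBlockAffine h v a b) : g = h := by
  ext1 y; rcases y with i | i
  · rw [(hg i).1, (hh i).1]
  · rw [(hg i).2, (hh i).2]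

theorem IsSwapAffine.ext (hg : IsSwapAffine g v a b) (hh : IsSwapAffine h v a b) : g = h := by
  ext1 y; rcases y with i | i
  · rw [(hg i).1, (hh i).1]
  · rw [(hg i).2, (hh i).2]

theorem IsBlockAffine.inj (hg : IsBlockAffine g v a b) (hh : IsBlockAffine g w c d) :
    v = w ∧ a = c ∧ b = d := by
  have h0 := (hg 0).1.symm.trans (hh 0).1
  have h1 := (hg 1).1.symm.trans (hh 1).1
  have h2 := (hg 0).2.symm.trans (hh 0).2
  simp only [r.injEq, sr.injEq] at h0 h1 h2
  refine ⟨by linear_combination h1 - h0, by linear_combination h0, by linear_combination h2⟩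

theorem IsSwapAffine.inj (hg : IsSwapAffine g v a b) (hh : IsSwapAffine g w c d) :
    v = w ∧ a = c ∧ b = d := by
  have h0 := (hg 0).1.symm.trans (hh 0).1
  have h1 := (hg 1).1.symm.trans (hh 1).1
  have h2 := (hg 0).2.symm.trans (hh 0).2
  simp only [r.injEq, sr.injEq] at h0 h1 h2
  refine ⟨by linear_combination h1 - h0, by linear_combination h0, by linear_combination h2⟩

theorem IsBlockAffine.mul (hg : IsBlockAffine g v a b) (hh : IsBlockAffine h w c d) :
    IsBlockAffine (g * h) (v * w) (v * c + a) (v * d + b) := by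
  intro i
  rw [Equiv.Perm.mul_apply, Equiv.Perm.mul_apply, (hh i).1, (hh i).2, (hg _).1, (hg _).2]
  constructor <;> congr 1 <;> ring

theorem IsBlockAffine.mul_swap (hg : IsBlockAffine g v a b) (hh : IsSwapAffine h w c d) :
    IsSwapAffine (g * h) (v * w) (v * c + b) (v * d + a) := by
  intro i
  rw [Equiv.Perm.mul_apply, Equiv.Perm.mul_apply, (hh i).1, (hh i).2, (hg _).1, (hg _).2]
  constructor <;> congr 1 <;> ring

theorem IsSwapAffine.mul_block (hg : IsSwapAffine g v a b) (hh : IsBlockAffine h w c d) :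
    IsSwapAffine (g * h) (v * w) (v * c + a) (v * d + b) := by
  intro i
  rw [Equiv.Perm.mul_apply, Equiv.Perm.mul_apply, (hh i).1, (hh i).2, (hg _).1, (hg _).2]
  constructor <;> congr 1 <;> ring

theorem IsSwapAffine.mul (hg : IsSwapAffine g v a b) (hh : IsSwapAffine h w c d) :
    IsBlockAffine (g * h) (v * w) (v * c + b) (v * d + a) := by
  intro i
  rw [Equiv.Perm.mul_apply, Equiv.Perm.mul_apply, (hh i).1, (hh i).2, (hg _).1, (hg _).2]
  constructor <;> congr 1 <;> ring

theorem isUnit_of_injective_affine [NeZero n] (h : Function.Injective fun i : ZMod n => v * i + a) :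
    IsUnit v := by
  have h1 : Function.Injective fun i : ZMod n => v * i := fun x y hxy => h (by simpa using hxy)
  obtain ⟨w, hw⟩ := (Finite.injective_iff_surjective.1 h1) 1
  exact IsUnit.of_mul_eq_one w hw

theorem IsBlockAffine.isUnit [NeZero n] (hg : IsBlockAffine g v a b) : IsUnit v := by
  refine isUnit_of_injective_affine (a := a) fun i j hij => ?_
  have : g (r i) = g (r j) := by rw [(hg i).1, (hg j).1]; exact congrArg r hij
  simpa using this

theorem IsSwapAffine.isUnit [NeZero n] (hg : IsSwapAffine g v a b) : IsUnit v := by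
  refine isUnit_of_injective_affine (a := a) fun i j hij => ?_
  have : g (r i) = g (r j) := by rw [(hg i).1, (hg j).1]; exact congrArg sr hij
  simpa using this

theorem IsBlockAffine.pow_one (hg : IsBlockAffine g 1 a b) (k : ℕ) :
    IsBlockAffine (g ^ k) 1 (k * a) (k * b) := by
  induction k with
  | zero => simpa using isBlockAffine_one
  | succ k ih =>
    have := ih.mul hg
    rw [pow_succ]
    convert this using 1 <;> push_cast <;> ring

theorem IsBlockAffine.exists_pow (hg : IsBlockAffine g v a b) (k : ℕ) :
    ∃ c d, IsBlockAffine (g ^ k) (v ^ k) c d := by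
  induction k with
  | zero => exact ⟨0, 0, by simpa using isBlockAffine_one⟩
  | succ k ih =>
    obtain ⟨c, d, h⟩ := ih
    rw [pow_succ, pow_succ]
    exact ⟨_, _, h.mul hg⟩

theorem isBlockAffine_or_isSwapAffine_of_mem_leftReg (hg : g ∈ leftReg (DihedralGroup n)) :
    (∃ k, IsBlockAffine g 1 k (-k)) ∨ ∃ k, IsSwapAffine g 1 k (-k) := by
  obtain ⟨d, hd⟩ := mem_leftReg.1 hg
  rcases d with k | k
  · refine Or.inl ⟨k, fun i => ?_⟩
    rw [hd, hd, r_mul_r, r_mul_sr]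
    constructor <;> congr 1 <;> ring
  · refine Or.inr ⟨k, fun i => ?_⟩
    rw [hd, hd, sr_mul_r, sr_mul_sr]
    constructor <;> congr 1 <;> ring

theorem IsBlockAffine.mem_leftReg {k : ZMod n} (hg : IsBlockAffine g 1 k (-k)) :
    g ∈ leftReg (DihedralGroup n) := by
  refine _root_.mem_leftReg.2 ⟨r k, ?_⟩
  rintro (i | i)
  · rw [(hg i).1, r_mul_r]; congr 1; ring
  · rw [(hg i).2, r_mul_sr]; congr 1; ring

theorem IsSwapAffine.mem_leftReg {k : ZMod n} (hg : IsSwapAffine g 1 k (-k)) :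
    g ∈ leftReg (DihedralGroup n) := by
  refine _root_.mem_leftReg.2 ⟨sr k, ?_⟩
  rintro (i | i)
  · rw [(hg i).1, sr_mul_r]; congr 1; ring
  · rw [(hg i).2, sr_mul_sr]; congr 1; ring

theorem IsBlockAffine.inv [NeZero n] (hg : IsBlockAffine g v a b) :
    ∃ w, v * w = 1 ∧ IsBlockAffine g⁻¹ w (-(w * a)) (-(w * b)) := by
  obtain ⟨w, hw⟩ := hg.isUnit.exists_right_inv
  refine ⟨w, hw, fun i => ?_⟩
  rw [Equiv.Perm.inv_eq_iff_eq, Equiv.Perm.inv_eq_iff_eq, (hg _).1, (hg _).2]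
  constructor <;> congr 1
  · linear_combination (a - i) * hw
  · linear_combination (b - i) * hw

theorem IsSwapAffine.inv [NeZero n] (hg : IsSwapAffine g v a b) :
    ∃ w, v * w = 1 ∧ IsSwapAffine g⁻¹ w (-(w * b)) (-(w * a)) := by
  obtain ⟨w, hw⟩ := hg.isUnit.exists_right_inv
  refine ⟨w, hw, fun i => ?_⟩
  rw [Equiv.Perm.inv_eq_iff_eq, Equiv.Perm.inv_eq_iff_eq, (hg _).1, (hg _).2]
  constructor <;> congr 1
  · linear_combination (b - i) * hw
  · linear_combination (a - i) * hw

theorem mem_hol_of_conj [NeZero n]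
    (H : ∀ x ∈ leftReg (DihedralGroup n), g * x * g⁻¹ ∈ leftReg (DihedralGroup n)) :
    g ∈ hol (DihedralGroup n) :=
  Subgroup.mem_normalizer_fintype H

theorem IsBlockAffine.mem_hol [NeZero n] (hg : IsBlockAffine g v a b) :
    g ∈ hol (DihedralGroup n) := by
  obtain ⟨w, hw, hi⟩ := hg.inv
  refine mem_hol_of_conj fun x hx => ?_
  rcases isBlockAffine_or_isSwapAffine_of_mem_leftReg hx with ⟨k, hk⟩ | ⟨k, hk⟩
  · have := (hg.mul hk).mul hi
    apply IsBlockAffine.mem_leftReg (k := v * k)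
    convert this using 1
    · linear_combination -hw
    · linear_combination a * hw
    · linear_combination b * hw
  · have := (hg.mul_swap hk).mul_block hi
    apply IsSwapAffine.mem_leftReg (k := v * k + b - a)
    convert this using 1
    · linear_combination -hw
    · linear_combination a * hw
    · linear_combination b * hw

theorem IsSwapAffine.mem_hol [NeZero n] (hg : IsSwapAffine g v a b) :
    g ∈ hol (DihedralGroup n) := by
  obtain ⟨w, hw, hi⟩ := hg.inv
  refine mem_hol_of_conj fun x hx => ?_
  rcases isBlockAffine_or_isSwapAffine_of_mem_leftReg hx with ⟨k, hk⟩ | ⟨k, hk⟩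
  · have := (hg.mul_block hk).mul hi
    apply IsBlockAffine.mem_leftReg (k := -(v * k))
    convert this using 1
    · linear_combination -hw
    · linear_combination b * hw
    · linear_combination a * hw
  · have := (hg.mul hk).mul_swap hi
    apply IsSwapAffine.mem_leftReg (k := -(v * k) + a - b)
    convert this using 1
    · linear_combination -hw
    · linear_combination b * hw
    · linear_combination a * hw

/-- For `n ≥ 3` the holomorph of `D_n` consists of the affine maps. -/
theorem isBlockAffine_or_isSwapAffine_of_mem_hol (hn : 3 ≤ n) (hg : g ∈ hol (DihedralGroup n)) :
    (∃ v a b, IsBlockAffine g v a b) ∨ ∃ v a b, IsSwapAffine g v a b := by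
  have : NeZero n := ⟨by omega⟩
  have : Fact (1 < n) := ⟨by omega⟩
  have hconj : ∀ d : DihedralGroup n, ∃ d', ∀ y, g (d * y) = d' * g y := by
    intro d
    have h1 : conjLeftReg g = leftReg _ := mem_hol_iff.1 hg
    have h2 : g * MulAction.toPermHom _ _ d * g⁻¹ ∈ conjLeftReg g := by
      rw [mem_conjLeftReg]
      exact ⟨d, fun y => by simp⟩
    rw [h1] at h2
    obtain ⟨d', hd'⟩ := mem_leftReg.1 h2
    exact ⟨d', fun y => by simpa using hd' (g y)⟩
  obtain ⟨d, hd⟩ := hconj (r 1)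
  have h2 : (2 : ZMod n) ≠ 0 := by
    intro h
    have : ((2 : ℕ) : ZMod n) = 0 := by exact_mod_cast h
    rw [ZMod.natCast_eq_zero_iff] at this
    have := Nat.le_of_dvd (by norm_num) this
    omega
  -- A reflection squares to `1`, while `x² ≠ 1` because `n ≥ 3`; so conjugation by `g` sends `x` to
  -- a rotation.
  rcases d with v | v
  swap
  · exfalso
    have e : g (r 1 * (r 1 * r 0)) = g (r 0) := by
      rw [hd, hd, ← mul_assoc, sr_mul_self, one_mul]
    have e' := g.injective e
    rw [r_mul_r, r_mul_r, r.injEq] at e'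
    exact h2 (by linear_combination e')
  have key : ∀ (k : ℕ) (y : DihedralGroup n), g (r (k : ZMod n) * y) = r (v * (k : ZMod n)) * g y := by
    intro k
    induction k with
    | zero => intro y; simp only [Nat.cast_zero, mul_zero, r_zero, one_mul]
    | succ k ih =>
      intro y
      have : (r ((k + 1 : ℕ) : ZMod n) : DihedralGroup n) = r 1 * r (k : ZMod n) := by
        rw [r_mul_r]; congr 1; push_cast; ring
      rw [this, mul_assoc, hd, ih, ← mul_assoc, r_mul_r]
      congr 2
      push_cast; ring
  have key' : ∀ (k : ZMod n) (y : DihedralGroup n), g (r k * y) = r (v * k) * g y := by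
    intro k y
    have := key k.val y
    simpa using this
  have hr : ∀ i, g (r i) = r (v * i) * g (r 0) := by
    intro i
    have := key' i (r 0)
    simpa using this
  have hsr : ∀ i, g (sr i) = r (v * (-i)) * g (sr 0) := by
    intro i
    have := key' (-i) (sr 0)
    simpa using this
  have hv : IsUnit v := by
    refine isUnit_of_injective_affine (a := 0) fun i j hij => ?_
    have : g (r i) = g (r j) := by rw [hr i, hr j]; simp at hij; rw [hij]
    simpa using this
  obtain ⟨w, hw⟩ := hv.exists_right_inv
  -- The images of the two blocks are orbits of the rotations, as `v` is a unit. If both images were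
  -- the same block, `g` would not be injective.
  rcases h0 : g (r 0) with a | a <;> rcases h1 : g (sr 0) with b | b
  · exfalso
    have : g (r (w * (b - a))) = g (sr 0) := by
      rw [hr, h0, h1, r_mul_r]; congr 1; linear_combination (b - a) * hw
    simp at this
  · refine Or.inl ⟨v, a, b, fun i => ?_⟩
    rw [hr, hsr, h0, h1, r_mul_r, r_mul_sr]
    constructor <;> (congr 1 <;> ring)
  · refine Or.inr ⟨-v, a, b, fun i => ?_⟩
    rw [hr, hsr, h0, h1, r_mul_r, r_mul_sr]
    constructor <;> congr 1 <;> ring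
  · exfalso
    have : g (r (w * (a - b))) = g (sr 0) := by
      rw [hr, h0, h1, r_mul_sr]; congr 1; linear_combination (b - a) * hw
    simp at this

end Forms

/-! ### The conjugates by `τ_u`. -/

section Dihedral

open DihedralGroup

variable {n : ℕ}

theorem tau_mul_self {u : (ZMod n)ˣ} (hu : u ^ 2 = 1) : tau n u * tau n u = 1 := by
  have hu' : (u : ZMod n) * u = 1 := by rw [← Units.val_mul, ← sq, hu, Units.val_one]
  ext1 y
  rcases y with i | i
  · rfl
  · change sr ((u : ZMod n) * ((u : ZMod n) * i)) = sr i
    rw [← mul_assoc, hu', one_mul]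

theorem tau_inv {u : (ZMod n)ˣ} (hu : u ^ 2 = 1) : (tau n u)⁻¹ = tau n u :=
  inv_eq_of_mul_eq_one_left (tau_mul_self hu)

theorem tau_conj_mem_hol (hn : 3 ≤ n) {u : (ZMod n)ˣ} (hu : u ^ 2 = 1)
    {h : Equiv.Perm (DihedralGroup n)} (hh : h ∈ hol (DihedralGroup n)) :
    tau n u * h * tau n u ∈ hol (DihedralGroup n) := by
  have : NeZero n := ⟨by omega⟩
  have hu' : (u : ZMod n) * u = 1 := by rw [← Units.val_mul, ← sq, hu, Units.val_one]
  rcases isBlockAffine_or_isSwapAffine_of_mem_hol hn hh with ⟨v, a, b, H⟩ | ⟨v, a, b, H⟩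
  · refine IsBlockAffine.mem_hol (v := v) (a := a) (b := u * b) fun i => ?_
    constructor
    · change tau n u (h (r i)) = _
      rw [(H i).1]; rfl
    · change tau n u (h (sr ((u : ZMod n) * i))) = _
      rw [(H _).2]
      change sr ((u : ZMod n) * (v * ((u : ZMod n) * i) + b)) = _
      congr 1
      linear_combination (v * i) * hu'
  · refine IsSwapAffine.mem_hol (v := u * v) (a := u * a) (b := b) fun i => ?_
    constructor
    · change tau n u (h (r i)) = _
      rw [(H i).1]
      change sr ((u : ZMod n) * (v * i + a)) = _
      congr 1; ring
    · change tau n u (h (sr ((u : ZMod n) * i))) = _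
      rw [(H _).2]
      change r (v * ((u : ZMod n) * i) + b) = _
      congr 1; ring

theorem conjLeftReg_tau_le_hol (hn : 3 ≤ n) {u : (ZMod n)ˣ} (hu : u ^ 2 = 1) :
    conjLeftReg (tau n u) ≤ hol (DihedralGroup n) := by
  intro x hx
  rw [conjLeftReg_eq, mem_conjSubgroup] at hx
  have := tau_conj_mem_hol hn hu (leftReg_le_hol hx)
  rw [tau_inv hu] at this
  have e : tau n u * (tau n u * x * tau n u) * tau n u
      = (tau n u * tau n u) * x * (tau n u * tau n u) := by group
  rwa [e, tau_mul_self hu, one_mul, mul_one] at this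

theorem conjLeftReg_tau_mem_classQ (hn : 3 ≤ n) {u : (ZMod n)ˣ} (hu : u ^ 2 = 1) :
    conjLeftReg (tau n u) ∈ classQ (DihedralGroup n) := by
  refine conjLeftReg_mem_classQ (conjLeftReg_tau_le_hol hn hu) fun N hN x hx => ?_
  rw [mem_normOf_conjLeftReg, tau_inv hu]
  exact tau_conj_mem_hol hn hu (hN.2.2 hx)

/-- `τ_u τ_v` has multiplier `1` on one block and `u v` on the other, so it is in the holomorph only
if `u v = 1`. -/
theorem tau_injOn (hn : 3 ≤ n) {u v : (ZMod n)ˣ} (hu : u ^ 2 = 1)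
    (h : conjLeftReg (tau n u) = conjLeftReg (tau n v)) : u = v := by
  have h1 := conjLeftReg_eq_conjLeftReg_iff.1 h
  rw [tau_inv hu] at h1
  have hu' : (u : ZMod n) * u = 1 := by rw [← Units.val_mul, ← sq, hu, Units.val_one]
  have hr : ∀ i, (tau n u * tau n v) (r i) = r i := fun i => rfl
  have hs : ∀ i, (tau n u * tau n v) (sr i) = sr ((u : ZMod n) * ((v : ZMod n) * i)) := fun i => rfl
  rcases isBlockAffine_or_isSwapAffine_of_mem_hol hn h1 with ⟨w, a, b, H⟩ | ⟨w, a, b, H⟩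
  · have e0 := (H 0).1
    have e1 := (H 1).1
    have e2 := (H 0).2
    have e3 := (H 1).2
    rw [hr, r.injEq] at e0 e1
    rw [hs, sr.injEq] at e2 e3
    apply Units.ext
    linear_combination v * hu' - u * (e3 - e2 + e0 - e1)
  · have e0 := (H 0).1
    rw [hr] at e0
    cases e0

/-! ### Dihedral generators of the members of `𝓢(D_n)`. -/

/-- `X` and `T` generate `N` and satisfy the relations of the dihedral group of order `2n`. -/
structure IsDihedralPair (n : ℕ) {B : Type*} [Group B] (N : Subgroup B) (X T : B) : Prop where
  rot_mem : X ∈ N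
  refl_mem : T ∈ N
  rel : X * T * X = T
  refl_sq : T * T = 1
  rot_pow : X ^ n = 1
  dvd_of_pow : ∀ k : ℕ, X ^ k = 1 → n ∣ k
  cases : ∀ g ∈ N, ∃ k : ℕ, g = X ^ k ∨ g = T * X ^ k

theorem exists_isDihedralPair [NeZero n] {B : Type*} [Group B] {N : Subgroup B}
    (h : Nonempty (N ≃* DihedralGroup n)) : ∃ X T, IsDihedralPair n N X T := by
  obtain ⟨e⟩ := h
  refine ⟨e.symm (r 1), e.symm (sr 0), (e.symm (r 1)).2, (e.symm (sr 0)).2, ?_, ?_, ?_, ?_, ?_⟩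
  · rw [← Subgroup.coe_mul, ← Subgroup.coe_mul, ← map_mul, ← map_mul]
    simp
  · rw [← Subgroup.coe_mul, ← map_mul]
    simp
  · rw [← Subgroup.coe_pow, ← map_pow]
    simp
  · intro k hk
    rw [← Subgroup.coe_pow, ← map_pow, OneMemClass.coe_eq_one, map_eq_one_iff _ e.symm.injective] at hk
    rw [← orderOf_r_one (n := n)]
    exact orderOf_dvd_of_pow_eq_one hk
  · intro g hg
    rcases hd : e ⟨g, hg⟩ with k | k
    · refine ⟨k.val, Or.inl ?_⟩
      rw [← Subgroup.coe_pow, ← map_pow, r_one_pow, ZMod.natCast_zmod_val, ← hd]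
      simp
    · refine ⟨k.val, Or.inr ?_⟩
      rw [← Subgroup.coe_pow, ← map_pow, r_one_pow, ZMod.natCast_zmod_val, ← Subgroup.coe_mul,
        ← map_mul, sr_mul_r, zero_add, ← hd]
      simp

theorem IsDihedralPair.mul_rot {B : Type*} [Group B] {N : Subgroup B} {X T : B} [NeZero n]
    (h : IsDihedralPair n N X T) : IsDihedralPair n N X (T * X) where
  rot_mem := h.rot_mem
  refl_mem := mul_mem h.refl_mem h.rot_mem
  rel := by rw [← mul_assoc, h.rel]
  refl_sq := by
    have : T * X * (T * X) = T * (X * T * X) := by group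
    rw [this, h.rel, h.refl_sq]
  rot_pow := h.rot_pow
  dvd_of_pow := h.dvd_of_pow
  cases := by
    intro g hg
    obtain ⟨k, rfl | rfl⟩ := h.cases g hg
    · exact ⟨k, Or.inl rfl⟩
    -- `T = (T X) X⁻¹`, and `X⁻¹ = X ^ (n - 1)`.
    · refine ⟨n - 1 + k, Or.inr ?_⟩
      have hn : X * X ^ (n - 1) = 1 := by
        rw [← pow_succ', Nat.sub_add_cancel (Nat.one_le_iff_ne_zero.2 (NeZero.ne n)), h.rot_pow]
      rw [mul_assoc, pow_add, ← mul_assoc X, hn, one_mul]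

theorem IsDihedralPair.mul_rot_pow {B : Type*} [Group B] {N : Subgroup B} {X T : B} [NeZero n]
    (h : IsDihedralPair n N X T) (k : ℕ) : IsDihedralPair n N X (T * X ^ k) := by
  induction k with
  | zero => simpa using h
  | succ k ih => rw [pow_succ, ← mul_assoc]; exact ih.mul_rot

theorem IsDihedralPair.conjSubgroup {B : Type*} [Group B] {N : Subgroup B} {X T : B}
    (h : IsDihedralPair n N X T) (b : B) :
    IsDihedralPair n (conjSubgroup b N) (b * X * b⁻¹) (b * T * b⁻¹) where
  rot_mem := mem_conjSubgroup.2 (by simpa [mul_assoc] using h.rot_mem)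
  refl_mem := mem_conjSubgroup.2 (by simpa [mul_assoc] using h.refl_mem)
  rel := by
    have : b * X * b⁻¹ * (b * T * b⁻¹) * (b * X * b⁻¹) = b * (X * T * X) * b⁻¹ := by group
    rw [this, h.rel]
  refl_sq := by
    have : b * T * b⁻¹ * (b * T * b⁻¹) = b * (T * T) * b⁻¹ := by group
    rw [this, h.refl_sq]; group
  rot_pow := by rw [conj_pow, h.rot_pow]; group
  dvd_of_pow := by
    intro k hk
    refine h.dvd_of_pow k ?_
    rw [conj_pow] at hk
    simpa using hk
  cases := by
    intro g hg
    obtain ⟨k, hk | hk⟩ := h.cases _ (mem_conjSubgroup.1 hg)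
    · refine ⟨k, Or.inl ?_⟩
      rw [conj_pow, ← hk]; group
    · refine ⟨k, Or.inr ?_⟩
      have : b * T * b⁻¹ * (b * X * b⁻¹) ^ k = b * (T * X ^ k) * b⁻¹ := by rw [conj_pow]; group
      rw [this, ← hk]; group

variable {N M : Subgroup (Equiv.Perm (DihedralGroup n))} {X T g : Equiv.Perm (DihedralGroup n)}
  {v w s a b c d : ZMod n}

/-- Otherwise all of `N` would preserve the blocks, against transitivity. -/
theorem IsDihedralPair.exists_isSwapAffine (hn : 3 ≤ n) (hN : N ∈ classS (DihedralGroup n))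
    (h : IsDihedralPair n N X T) (hX : IsBlockAffine X w a b) :
    ∃ s c d, IsSwapAffine T s c d := by
  refine (isBlockAffine_or_isSwapAffine_of_mem_hol hn (hN.2.2 h.refl_mem)).resolve_left ?_
  rintro ⟨s, c, d, hT⟩
  obtain ⟨g, ⟨hg, hgx⟩, -⟩ := hN.1 (r 0) (sr 0)
  obtain ⟨k, rfl | rfl⟩ := h.cases g hg
  · obtain ⟨_, _, hk⟩ := hX.exists_pow k
    rw [(hk 0).1] at hgx
    simp at hgx
  · obtain ⟨_, _, hk⟩ := hX.exists_pow k
    rw [((hT.mul hk) 0).1] at hgx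
    simp at hgx

/-- The generators of a member of `𝓢(D_n)` can be chosen so that the rotation preserves
the blocks and the reflection exchanges them, or vice versa. -/
theorem exists_isDihedralPair_of_mem_classS (hn : 3 ≤ n) (hN : N ∈ classS (DihedralGroup n)) :
    ∃ X T, IsDihedralPair n N X T ∧
      ((∃ w a b s c d, w * w = 1 ∧ IsBlockAffine X w a b ∧ IsSwapAffine T s c d) ∨
        ∃ w a b s c d, w * w = 1 ∧ IsSwapAffine X w a b ∧ IsBlockAffine T s c d) := by
  have : NeZero n := ⟨by omega⟩
  obtain ⟨X, T, h⟩ := exists_isDihedralPair hN.2.1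
  have key : ∀ {w s : ZMod n}, IsUnit s → w * s * w = s → w * w = 1 := by
    intro w s hs e
    apply hs.mul_left_cancel
    linear_combination e
  rcases isBlockAffine_or_isSwapAffine_of_mem_hol hn (hN.2.2 h.rot_mem) with
    ⟨w, a, b, hX⟩ | ⟨w, a, b, hX⟩
  · obtain ⟨s, c, d, hT⟩ := h.exists_isSwapAffine hn hN hX
    refine ⟨X, T, h, Or.inl ⟨w, a, b, s, c, d, ?_, hX, hT⟩⟩
    have := (hX.mul_swap hT).mul_block hX
    rw [h.rel] at this
    exact key hT.isUnit (this.inj hT).1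
  · rcases isBlockAffine_or_isSwapAffine_of_mem_hol hn (hN.2.2 h.refl_mem) with
      ⟨s, c, d, hT⟩ | ⟨s, c, d, hT⟩
    · refine ⟨X, T, h, Or.inr ⟨w, a, b, s, c, d, ?_, hX, hT⟩⟩
      have := (hX.mul_block hT).mul hX
      rw [h.rel] at this
      exact key hT.isUnit (this.inj hT).1
    -- If both generators exchange the blocks, `T X` is a reflection that preserves them.
    · have hT' := hT.mul hX
      refine ⟨X, T * X, h.mul_rot, Or.inr ⟨w, a, b, _, _, _, ?_, hX, hT'⟩⟩
      have := (hX.mul_block hT').mul hX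
      rw [h.mul_rot.rel] at this
      exact key hT'.isUnit (this.inj hT').1

/-- A member of `𝓢(D_n)` whose rotations are translations on both blocks is `τ_u λ τ_u⁻¹`. -/
theorem eq_conjLeftReg_tau (hn : 3 ≤ n) (hN : N ∈ classS (DihedralGroup n))
    (h : IsDihedralPair n N X T) (hX : IsBlockAffine X 1 a b) :
    ∃ u : (ZMod n)ˣ, u ^ 2 = 1 ∧ N = conjLeftReg (tau n u) := by
  have : NeZero n := ⟨by omega⟩
  -- This choice of reflection makes one translation part `0`; `T₀² = 1` then kills the other and
  -- gives `s² = 1`.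
  obtain ⟨T₀, ⟨hT₀, hT₀0⟩, -⟩ := hN.1 (r 0) (sr 0)
  have h0 : IsDihedralPair n N X T₀ := by
    obtain ⟨k, rfl | rfl⟩ := h.cases T₀ hT₀
    · rw [(hX.pow_one k 0).1] at hT₀0
      simp at hT₀0
    · exact h.mul_rot_pow k
  obtain ⟨s, d, hT⟩ : ∃ s d, IsSwapAffine T₀ s 0 d := by
    rcases isBlockAffine_or_isSwapAffine_of_mem_hol hn (hN.2.2 hT₀) with
      ⟨s, c, d, hT⟩ | ⟨s, c, d, hT⟩
    · rw [(hT 0).1] at hT₀0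
      simp at hT₀0
    · have := hT₀0
      rw [(hT 0).1, sr.injEq, mul_zero, zero_add] at this
      subst this
      exact ⟨s, d, hT⟩
  have e1 := hT.mul hT
  rw [h0.refl_sq] at e1
  obtain ⟨hs, hd, -⟩ := e1.inj isBlockAffine_one
  have hd0 : d = 0 := by linear_combination hd
  subst hd0
  have e2 := (hX.mul_swap hT).mul_block hX
  rw [h0.rel] at e2
  obtain ⟨-, hb, -⟩ := e2.inj hT
  -- The relation `X T₀ X = T₀` ties the two translations of `X` by `b = -s a`, so the rotation with
  -- translation `1` on the first block has translation `-s` on the other. This is `τ_s` applied to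
  -- `λ(x)`.
  obtain ⟨Y, ⟨hY, hY0⟩, -⟩ := hN.1 (r 0) (r 1)
  have hYf : IsBlockAffine Y 1 1 (-s) := by
    obtain ⟨k, rfl | rfl⟩ := h0.cases Y hY
    · have hk := hX.pow_one k
      have := hY0
      rw [(hk 0).1, r.injEq] at this
      convert hk using 1
      · linear_combination -this
      · linear_combination (-(k : ZMod n)) * hb + s * this
    · rw [((hT.mul_block (hX.pow_one k)) 0).1] at hY0
      simp at hY0
  refine ⟨⟨s, s, hs, hs⟩, Units.ext (by simpa [sq] using hs), ?_⟩
  refine ((isRegularPerm_leftReg.conjSubgroup _).eq_of_le hN.1 fun x hx => ?_).symm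
  obtain ⟨δ, hδ⟩ := mem_conjLeftReg.1 hx
  have hYp : ∀ k : ZMod n, IsBlockAffine (Y ^ k.val) 1 k (-(s * k)) := by
    intro k
    have := hYf.pow_one k.val
    rw [ZMod.natCast_zmod_val] at this
    convert this using 1 <;> ring
  have hsurj : ∀ f g : Equiv.Perm (DihedralGroup n),
      (∀ y, f (tau n ⟨s, s, hs, hs⟩ y) = g (tau n ⟨s, s, hs, hs⟩ y)) → f = g := by
    intro f g H
    ext1 z
    have := H ((tau n ⟨s, s, hs, hs⟩).symm z)
    simpa using this
  rcases δ with k | k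
  · have : x = Y ^ k.val := by
      refine hsurj _ _ fun y => ?_
      rw [hδ]
      rcases y with i | i
      · rw [r_mul_r]
        refine Eq.trans ?_ (hYp k i).1.symm
        change r _ = _
        congr 1; ring
      · rw [r_mul_sr]
        refine Eq.trans ?_ (hYp k (s * i)).2.symm
        change sr (s * _) = _
        congr 1; ring
    rw [this]
    exact pow_mem hY _
  · have : x = T₀ * Y ^ k.val := by
      have hf := hT.mul_block (hYp k)
      refine hsurj _ _ fun y => ?_
      rw [hδ]
      rcases y with i | i
      · rw [sr_mul_r]
        refine Eq.trans ?_ (hf i).1.symm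
        change sr (s * _) = _
        congr 1; ring
      · rw [sr_mul_sr]
        refine Eq.trans ?_ (hf (s * i)).2.symm
        change r _ = _
        congr 1; linear_combination (k - i) * hs
    rw [this]
    exact mul_mem hT₀ (pow_mem hY _)

/-- The shift of the block `{x ^ i}` that fixes `{t x ^ i}`. -/
def rotationShift (n : ℕ) : Equiv.Perm (DihedralGroup n) where
  toFun
    | .r i => .r (i + 1)
    | .sr i => .sr i
  invFun
    | .r i => .r (i - 1)
    | .sr i => .sr i
  left_inv := by rintro (i | i) <;> simp
  right_inv := by rintro (i | i) <;> simp

theorem isBlockAffine_rotationShift : IsBlockAffine (rotationShift n) 1 1 0 := by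
  intro i
  rw [one_mul, add_zero]
  exact ⟨rfl, rfl⟩

/-! ### Multipliers in the members of `𝓠(D_n)`. -/

/-- A block-preserving element of a member of `𝓠(D_n)` has a unipotent multiplier. -/
theorem one_sub_sq_eq_zero_of_mem_classQ [NeZero n] (hM : M ∈ classQ (DihedralGroup n)) (hg : g ∈ M)
    (hgf : IsBlockAffine g s c d) : (1 - s) * (1 - s) = 0 := by
  have hh := isBlockAffine_rotationShift (n := n)
  obtain ⟨w, hw, hi⟩ := hh.inv
  rw [one_mul] at hw
  subst hw
  set h := rotationShift n
  have hQ := conjSubgroup_mem_classQ hh.mem_hol hM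
  have hk : h * g * h⁻¹ ∈ normOf M :=
    hM.2 _ hQ.1 (mem_conjSubgroup.2 (by simpa [mul_assoc] using hg))
  have hkf := (hh.mul hgf).mul hi
  set k := h * g * h⁻¹
  have hmem : k * g * k⁻¹ * g⁻¹ ∈ M :=
    mul_mem ((Subgroup.mem_normalizer_iff.1 hk g).1 hg) (inv_mem hg)
  have f1 := hkf.mul hgf
  have f2 := hgf.mul hkf
  -- `h` is trivial on the block `{t x^i}`, so `k` and `g` agree there and `k g`, `g k` coincide on
  -- it.
  have hfix : (k * g * k⁻¹ * g⁻¹) ((g * k) (sr 0)) = (g * k) (sr 0) := by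
    have : (k * g * k⁻¹ * g⁻¹) ((g * k) (sr 0)) = (k * g) (sr 0) := by
      simp
    rw [this, (f1 0).2, (f2 0).2]
    congr 1; ring
  have h1 := hM.1.1.1.eq_one hmem hfix
  have hcomm : k * g = g * k := by
    rw [mul_inv_eq_one, mul_inv_eq_iff_eq_mul] at h1
    exact h1
  rw [hcomm] at f1
  -- On the block `{x^i}`, `k` has translation `c + 1 - s`; commuting with `g` means `(1 - s)² = 0`.
  have := (f1.inj f2).2.1
  linear_combination this

theorem IsSwapAffine.pow_two_mul (hX : IsSwapAffine X w a b) (hw : w * w = 1) (m : ℕ) :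
    IsBlockAffine (X ^ (2 * m)) 1 (m * (w * a + b)) (m * (w * b + a)) := by
  have := hX.mul hX
  rw [hw] at this
  rw [pow_mul, sq]
  exact this.pow_one m

theorem rotation_isBlockAffine_of_mem_classQ (hn : 3 ≤ n) (hn4 : n ≠ 4)
    (hM : M ∈ classQ (DihedralGroup n)) :
    ∃ X T w a b, IsDihedralPair n M X T ∧ IsBlockAffine X w a b ∧ w * w = 1 := by
  have : NeZero n := ⟨by omega⟩
  obtain ⟨X, T, h, ⟨w, a, b, s, c, d, hw, hX, hT⟩ | ⟨w, a, b, s, c, d, hw, hX, hT⟩⟩ :=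
    exists_isDihedralPair_of_mem_classS hn hM.1.1
  · exact ⟨X, T, w, a, b, h, hX, hw⟩
  exfalso
  have hs1 := one_sub_sq_eq_zero_of_mem_classQ hM h.refl_mem hT
  have hTT := hT.mul hT
  rw [h.refl_sq] at hTT
  obtain ⟨hss, hc, -⟩ := hTT.inj isBlockAffine_one
  have hX2 := hX.pow_two_mul hw 1
  have hrel : X ^ (2 * 1) * T * X ^ (2 * 1) = T := by
    have : X ^ (2 * 1) * T * X ^ (2 * 1) = X * (X * T * X) * X := by
      simp only [mul_one, sq, mul_assoc]
    rw [this, h.rel, h.rel]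
  have h2 := (hX2.mul hT).mul hX2
  rw [hrel] at h2
  have hg := (h2.inj hT).2.1
  -- `1 + s` annihilates the translations of `X²` and of `T` on `{x^i}`. The block-preserving
  -- subgroup they generate moves `x^0` to `x^1`, so `1 + s` annihilates `1`.
  have hs : 1 + s = 0 := by
    obtain ⟨Y, ⟨hY, hY0⟩, -⟩ := hM.1.1.1 (r 0) (r 1)
    obtain ⟨k, hk⟩ := h.cases Y hY
    rcases Nat.even_or_odd' k with ⟨m, rfl | rfl⟩
    · have hp := hX.pow_two_mul hw m
      rcases hk with rfl | rfl
      · rw [(hp 0).1, r.injEq] at hY0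
        push_cast at hg
        linear_combination (-1 - s) * hY0 + (m : ZMod n) * hg
      · rw [((hT.mul hp) 0).1, r.injEq] at hY0
        push_cast at hg
        linear_combination (-1 - s) * hY0 + (m : ZMod n) * s * hg + hc
    · have hp := (hX.pow_two_mul hw m).mul_swap hX
      rw [← pow_succ] at hp
      rcases hk with rfl | rfl
      · rw [(hp 0).1] at hY0
        simp at hY0
      · rw [((hT.mul_swap hp) 0).1] at hY0
        simp at hY0
  -- With `s = -1`, the identity `(1 - s)² = 0` reads `4 = 0`, so `n ∣ 4`.
  have h4 : ((4 : ℕ) : ZMod n) = 0 := by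
    push_cast
    linear_combination hs1 + (3 - s) * hs
  rw [ZMod.natCast_eq_zero_iff] at h4
  have := Nat.le_of_dvd (by norm_num) h4
  interval_cases n <;> omega

theorem eq_half_of_two_mul_eq_zero [NeZero n] {x : ZMod n} (hx : 2 * x = 0) (h0 : x ≠ 0) :
    2 ∣ n ∧ x = ((n / 2 : ℕ) : ZMod n) := by
  have h1 : ((2 * x.val : ℕ) : ZMod n) = 0 := by
    push_cast; rw [ZMod.natCast_zmod_val]; exact hx
  rw [ZMod.natCast_eq_zero_iff] at h1
  have h2 := ZMod.val_lt x
  have h3 : x.val ≠ 0 := by rwa [Ne, ZMod.val_eq_zero]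
  obtain ⟨k, hk⟩ := h1
  have hk1 : k = 1 := by
    have : k < 2 := by
      by_contra hcon
      have : n * 2 ≤ n * k := Nat.mul_le_mul_left _ (by omega)
      omega
    have : k ≠ 0 := by rintro rfl; omega
    omega
  subst hk1
  refine ⟨⟨x.val, by omega⟩, ?_⟩
  have : n / 2 = x.val := by omega
  rw [this, ZMod.natCast_zmod_val]

/-- The members of `𝓠(D_n)`: either `τ_u λ τ_u⁻¹`, or a group whose rotations have multiplier
`1 + n / 2` on the blocks. -/
theorem cases_of_mem_classQ (hn : 3 ≤ n) (hn4 : n ≠ 4) (hM : M ∈ classQ (DihedralGroup n)) :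
    (∃ u : (ZMod n)ˣ, u ^ 2 = 1 ∧ M = conjLeftReg (tau n u)) ∨
      (8 ∣ n ∧ ∃ X T a b, IsDihedralPair n M X T ∧
        IsBlockAffine X (1 + ((n / 2 : ℕ) : ZMod n)) a b) := by
  have : NeZero n := ⟨by omega⟩
  obtain ⟨X, T, w, a, b, h, hX, hw⟩ := rotation_isBlockAffine_of_mem_classQ hn hn4 hM
  have hw1 := one_sub_sq_eq_zero_of_mem_classQ hM h.rot_mem hX
  by_cases hw' : w = 1
  · subst hw'
    exact Or.inl (eq_conjLeftReg_tau hn hM.1.1 h hX)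
  right
  obtain ⟨h2, hx⟩ := eq_half_of_two_mul_eq_zero (x := w - 1) (by linear_combination hw - hw1)
    (sub_ne_zero.2 hw')
  obtain rfl : w = 1 + ((n / 2 : ℕ) : ZMod n) := by linear_combination hx
  refine ⟨?_, X, T, a, b, h, hX⟩
  obtain ⟨m, rfl⟩ := h2
  have hm : 2 * m / 2 = m := by omega
  rw [hm] at hw1 hX hw
  -- With `n = 2 m`, `(1 - w)² = 0` says `n ∣ m²`, so `m` is even and `n = 4 q`.
  have hmm : ((m * m : ℕ) : ZMod (2 * m)) = 0 := by
    push_cast; linear_combination hw1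
  rw [ZMod.natCast_eq_zero_iff] at hmm
  have hm2 : 2 ∣ m := Nat.dvd_of_mul_dvd_mul_right (by omega) hmm
  obtain ⟨q, rfl⟩ := hm2
  by_contra h8
  have hq : Odd q := by
    rw [← Nat.not_even_iff_odd]
    rintro ⟨t, rfl⟩
    exact h8 ⟨t, by ring⟩
  obtain ⟨t, rfl⟩ := hq
  have hX2 := hX.mul hX
  rw [hw, ← sq] at hX2
  have hXq := hX2.pow_one (2 * t + 1)
  rw [← pow_mul] at hXq
  have hz : ((2 * (2 * (2 * t + 1)) : ℕ) : ZMod (2 * (2 * (2 * t + 1)))) = 0 := ZMod.natCast_self _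
  push_cast at hz
  -- If `q` is odd, `X²` translates by `(2 + 2q) a` and `X^(2q)` by `2q (q + 1) a`, a multiple of
  -- `4q = n`; likewise for `b`. Then `X^(n/2) = 1`, although `X` has order `n`.
  have h1 : X ^ (2 * (2 * t + 1)) = 1 := by
    refine IsBlockAffine.ext hXq ?_
    convert isBlockAffine_one using 1
    · push_cast; linear_combination ((t + 1) * a) * hz
    · push_cast; linear_combination ((t + 1) * b) * hz
  have := Nat.le_of_dvd (by omega) (h.dvd_of_pow _ h1)
  omega

end Dihedral

/-! ### The permutation `θ` and its action on affine maps. -/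

section Theta

open DihedralGroup

variable {n : ℕ}

theorem four_dvd_of_eight_dvd (h8 : 8 ∣ n) : 4 ∣ n := dvd_trans (by norm_num) h8

/-- Reduction `ℤ/n → ℤ/4`. -/
def modFour (h8 : 8 ∣ n) : ZMod n →+* ZMod 4 := ZMod.castHom (four_dvd_of_eight_dvd h8) (ZMod 4)

/-- Doubling in `ℤ/4` records parity: `2 * modFour h8 x` is `0` for even `x` and `2` for odd `x`.
Parities are stated in this form throughout. -/
theorem two_mul_modFour_of_isUnit (h8 : 8 ∣ n) {v : ZMod n} (hv : IsUnit v) :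
    2 * modFour h8 v = 2 := by
  have h : IsUnit (modFour h8 v) := hv.map _
  revert h
  generalize modFour h8 v = x
  revert x; decide

theorem modFour_eq_val [NeZero n] (h8 : 8 ∣ n) (x : ZMod n) : modFour h8 x = (x.val : ZMod 4) := by
  conv_lhs => rw [← ZMod.natCast_zmod_val x]
  exact map_natCast _ _

theorem modFour_half (h8 : 8 ∣ n) : modFour h8 ((n / 2 : ℕ) : ZMod n) = 0 := by
  rw [map_natCast, ZMod.natCast_eq_zero_iff]
  omega

theorem half_add_half (h8 : 8 ∣ n) : ((n / 2 : ℕ) : ZMod n) + ((n / 2 : ℕ) : ZMod n) = 0 := by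
  rw [← Nat.cast_add, ZMod.natCast_eq_zero_iff]
  have : n / 2 + n / 2 = n := by omega
  rw [this]

theorem even_val_of_two_mul_modFour [NeZero n] (h8 : 8 ∣ n) {x : ZMod n}
    (hx : 2 * modFour h8 x = 0) : 2 ∣ x.val := by
  rw [modFour_eq_val] at hx
  have : ((2 * x.val : ℕ) : ZMod 4) = 0 := by exact_mod_cast hx
  rw [ZMod.natCast_eq_zero_iff] at this
  omega

theorem half_mul_congr [NeZero n] (h8 : 8 ∣ n) {x y : ZMod n}
    (h : 2 * modFour h8 x = 2 * modFour h8 y) :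
    ((n / 2 : ℕ) : ZMod n) * x = ((n / 2 : ℕ) : ZMod n) * y := by
  have h1 : 2 * modFour h8 (x - y) = 0 := by rw [map_sub]; linear_combination h
  obtain ⟨k, hk⟩ := even_val_of_two_mul_modFour h8 h1
  have h2 : ((n / 2 : ℕ) : ZMod n) * (x - y) = 0 := by
    rw [← ZMod.natCast_zmod_val (x - y), hk, ← Nat.cast_mul, ZMod.natCast_eq_zero_iff]
    refine ⟨k, ?_⟩
    have : n / 2 * 2 = n := by omega
    rw [← mul_assoc, this]
  linear_combination h2

/-- The parity of `⌈c / 2⌉`, as a function of `c` modulo `4`. -/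
def thetaBit {R : Type*} [Zero R] [One R] (c : ZMod 4) : R := if c = 1 ∨ c = 2 then 1 else 0

theorem map_thetaBit {R S : Type*} [Ring R] [Ring S] (f : R →+* S) (c : ZMod 4) :
    f (thetaBit c) = thetaBit c := by
  unfold thetaBit; split_ifs <;> simp

/-- Multiplication by `n/2` sees only the parity of `⌈c/2⌉`, which is periodic in `c` with period
`4`. -/
theorem thetaExp_eq [NeZero n] (h8 : 8 ∣ n) (c : ZMod n) :
    thetaExp n c = c + ((n / 2 : ℕ) : ZMod n) * thetaBit (modFour h8 c) := by
  rw [thetaExp, mul_comm, Nat.cast_mul]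
  congr 1
  apply half_mul_congr h8
  rw [map_thetaBit, map_natCast, modFour_eq_val h8]
  generalize c.val = k
  have hk := Nat.div_add_mod k 4
  have hlt := Nat.mod_lt k (show 4 > 0 by norm_num)
  generalize k / 4 = q at hk
  generalize k % 4 = s at hk hlt
  subst hk
  have e4 : (4 : ZMod 4) = 0 := rfl
  have e : ((4 * q + s + 1) / 2 : ℕ) = 2 * q + (s + 1) / 2 := by omega
  rw [e]
  push_cast
  rw [e4, zero_mul, zero_add, mul_add, ← mul_assoc, show (2 : ZMod 4) * 2 = 0 from rfl, zero_mul,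
    zero_add]
  interval_cases s <;> decide

/-- `8 ∣ n` makes `n/2` a multiple of `4`. Hence the correction term is the same before and after
`θ`, and applying it twice adds `n`. -/
theorem modFour_thetaExp [NeZero n] (h8 : 8 ∣ n) (c : ZMod n) :
    modFour h8 (thetaExp n c) = modFour h8 c := by
  rw [thetaExp_eq h8, map_add, map_mul, modFour_half, zero_mul, add_zero]

theorem thetaExp_thetaExp [NeZero n] (h8 : 8 ∣ n) (c : ZMod n) :
    thetaExp n (thetaExp n c) = c := by
  rw [thetaExp_eq h8 (thetaExp n c), modFour_thetaExp, thetaExp_eq h8]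
  linear_combination (thetaBit (modFour h8 c) : ZMod n) * half_add_half h8

theorem thetaFun_involutive [NeZero n] (h8 : 8 ∣ n) : Function.Involutive (thetaFun n) := by
  rintro (i | i)
  · exact congrArg r (thetaExp_thetaExp h8 i)
  · exact congrArg sr (thetaExp_thetaExp h8 i)

/-- The permutation `θ` of `D_n`. -/
def theta [NeZero n] (h8 : 8 ∣ n) : Equiv.Perm (DihedralGroup n) :=
  (thetaFun_involutive h8).toPerm

theorem theta_r [NeZero n] (h8 : 8 ∣ n) (i : ZMod n) : theta h8 (r i) = r (thetaExp n i) := rfl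

theorem theta_sr [NeZero n] (h8 : 8 ∣ n) (i : ZMod n) : theta h8 (sr i) = sr (thetaExp n i) := rfl

theorem theta_mul_self [NeZero n] (h8 : 8 ∣ n) : theta h8 * theta h8 = 1 :=
  Equiv.ext fun y => thetaFun_involutive h8 y

theorem theta_inv [NeZero n] (h8 : 8 ∣ n) : (theta h8)⁻¹ = theta h8 :=
  inv_eq_of_mul_eq_one_left (theta_mul_self h8)

/-- The change of multiplier of the affine map `i ↦ w i + e` under conjugation by `θ`. -/
def thetaTwist (h8 : 8 ∣ n) (w e : ZMod n) : ZMod n :=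
  ((n / 2 : ℕ) : ZMod n) * (1 + thetaBit (modFour h8 (w + e)) + thetaBit (modFour h8 e))

/-- `thetaBit c` is the parity of `c (c + 1) / 2`. For odd `w` its quadratic part is unchanged by `i
↦ w i + e`, so the corrections before and after leave a function affine in `i` modulo `2`. Its
values at `i = 0` and `i = 1` give the slope `thetaTwist`. -/
theorem thetaExp_affine [NeZero n] (h8 : 8 ∣ n) {w : ZMod n} (hw : 2 * modFour h8 w = 2)
    (e i : ZMod n) :
    thetaExp n (w * thetaExp n i + e) = (w + thetaTwist h8 w e) * i + thetaExp n e := by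
  have key : ((n / 2 : ℕ) : ZMod n) * (w * thetaBit (modFour h8 i) +
        thetaBit (modFour h8 w * modFour h8 i + modFour h8 e)) =
      ((n / 2 : ℕ) : ZMod n) * ((1 + thetaBit (modFour h8 (w + e)) + thetaBit (modFour h8 e)) * i +
        thetaBit (modFour h8 e)) := by
    apply half_mul_congr h8
    simp only [map_add, map_mul, map_thetaBit, map_one]
    revert hw
    generalize modFour h8 w = x
    generalize modFour h8 e = y
    generalize modFour h8 i = z
    revert x y z
    unfold thetaBit
    decide
  rw [thetaExp_eq h8 (w * thetaExp n i + e), map_add, map_mul, modFour_thetaExp, thetaExp_eq h8 i,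
    thetaExp_eq h8 e, thetaTwist]
  linear_combination key

/-- Hence translations of equal parity on the two blocks leave them with a common multiplier after
conjugation by `θ`. -/
theorem thetaTwist_congr [NeZero n] (h8 : 8 ∣ n) {w e e' : ZMod n} (hw : 2 * modFour h8 w = 2)
    (he : 2 * modFour h8 e = 2 * modFour h8 e') : thetaTwist h8 w e = thetaTwist h8 w e' := by
  apply half_mul_congr h8
  simp only [map_add, map_thetaBit, map_one]
  revert hw he
  generalize modFour h8 w = x
  generalize modFour h8 e = y
  generalize modFour h8 e' = z
  revert x y z
  unfold thetaBit
  decide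

/-- This is how `θ` exchanges the multipliers `1` and `1 + n/2`, both of which are `1` modulo `4`.
-/
theorem thetaTwist_of_odd [NeZero n] (h8 : 8 ∣ n) {w e : ZMod n} (hw : modFour h8 w = 1)
    (he : 2 * modFour h8 e = 2) : thetaTwist h8 w e = ((n / 2 : ℕ) : ZMod n) := by
  rw [← mul_one ((n / 2 : ℕ) : ZMod n)]
  apply half_mul_congr h8
  simp only [map_add, map_thetaBit, map_one, hw]
  revert he
  generalize modFour h8 e = y
  revert y
  unfold thetaBit
  decide

theorem thetaExp_mul [NeZero n] (h8 : 8 ∣ n) {w : ZMod n} (hw : modFour h8 w = 1) (i : ZMod n) :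
    thetaExp n (w * i) = w * thetaExp n i := by
  rw [thetaExp_eq h8, thetaExp_eq h8 i, map_mul, hw, one_mul, mul_add]
  have : ((n / 2 : ℕ) : ZMod n) * w = ((n / 2 : ℕ) : ZMod n) * 1 :=
    half_mul_congr h8 (by rw [hw, map_one])
  linear_combination (-thetaBit (modFour h8 i)) * this

/-- `c (c + 1) / 2` is symmetric under `c ↦ -1 - c`. -/
theorem thetaExp_reflect [NeZero n] (h8 : 8 ∣ n) (i : ZMod n) :
    thetaExp n (-1 - i) = -1 - thetaExp n i := by
  rw [thetaExp_eq h8, thetaExp_eq h8 i]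
  have : (thetaBit (modFour h8 (-1 - i)) : ZMod n) = thetaBit (modFour h8 i) := by
    rw [map_sub, map_neg, map_one]
    generalize modFour h8 i = x
    unfold thetaBit
    congr 1
    revert x; decide
  rw [this]
  linear_combination (thetaBit (modFour h8 i) : ZMod n) * half_add_half h8

/-! ### Even affine maps and the full list of members of `𝓠(D_n)`. -/

/-- An affine map whose two translation parts have the same parity. -/
def IsEvenAffine (h8 : 8 ∣ n) (g : Equiv.Perm (DihedralGroup n)) : Prop :=
  ∃ v a b, (IsBlockAffine g v a b ∨ IsSwapAffine g v a b) ∧ 2 * modFour h8 a = 2 * modFour h8 b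

variable {N M : Subgroup (Equiv.Perm (DihedralGroup n))} {X T g h : Equiv.Perm (DihedralGroup n)}
  {v w s a b c d : ZMod n}

theorem IsEvenAffine.mem_hol [NeZero n] {h8 : 8 ∣ n} (hg : IsEvenAffine h8 g) :
    g ∈ hol (DihedralGroup n) := by
  obtain ⟨v, a, b, H | H, -⟩ := hg
  exacts [H.mem_hol, H.mem_hol]

theorem IsEvenAffine.mul [NeZero n] {h8 : 8 ∣ n} (hg : IsEvenAffine h8 g)
    (hh : IsEvenAffine h8 h) : IsEvenAffine h8 (g * h) := by
  obtain ⟨v, a, b, H, hp⟩ := hg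
  obtain ⟨w, c, d, H', hp'⟩ := hh
  rcases H with H | H <;> rcases H' with H' | H' <;>
    have hv := two_mul_modFour_of_isUnit h8 H.isUnit
  · exact ⟨_, _, _, Or.inl (H.mul H'), by
      simp only [map_add, map_mul]; linear_combination hp + modFour h8 v * hp'⟩
  · exact ⟨_, _, _, Or.inr (H.mul_swap H'), by
      simp only [map_add, map_mul]; linear_combination -hp + modFour h8 v * hp'⟩
  · exact ⟨_, _, _, Or.inr (H.mul_block H'), by
      simp only [map_add, map_mul]; linear_combination hp + modFour h8 v * hp'⟩
  · exact ⟨_, _, _, Or.inl (H.mul H'), by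
      simp only [map_add, map_mul]; linear_combination -hp + modFour h8 v * hp'⟩

theorem isEvenAffine_one (h8 : 8 ∣ n) : IsEvenAffine h8 1 :=
  ⟨1, 0, 0, Or.inl isBlockAffine_one, rfl⟩

theorem IsEvenAffine.pow [NeZero n] {h8 : 8 ∣ n} (hg : IsEvenAffine h8 g) (k : ℕ) :
    IsEvenAffine h8 (g ^ k) := by
  induction k with
  | zero => simpa using isEvenAffine_one h8
  | succ k ih => rw [pow_succ]; exact ih.mul hg

theorem IsBlockAffine.theta_conj [NeZero n] (h8 : 8 ∣ n) (hg : IsBlockAffine g w a b)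
    (hp : 2 * modFour h8 a = 2 * modFour h8 b) :
    IsBlockAffine (theta h8 * g * theta h8) (w + thetaTwist h8 w a) (thetaExp n a)
      (thetaExp n b) := by
  have hw := two_mul_modFour_of_isUnit h8 hg.isUnit
  intro i
  rw [Equiv.Perm.mul_apply, Equiv.Perm.mul_apply, Equiv.Perm.mul_apply, Equiv.Perm.mul_apply,
    theta_r, theta_sr, (hg _).1, (hg _).2, theta_r, theta_sr, thetaExp_affine h8 hw,
    thetaExp_affine h8 hw, thetaTwist_congr h8 hw hp]
  exact ⟨rfl, rfl⟩

theorem IsSwapAffine.theta_conj [NeZero n] (h8 : 8 ∣ n) (hg : IsSwapAffine g w a b)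
    (hp : 2 * modFour h8 a = 2 * modFour h8 b) :
    IsSwapAffine (theta h8 * g * theta h8) (w + thetaTwist h8 w a) (thetaExp n a)
      (thetaExp n b) := by
  have hw := two_mul_modFour_of_isUnit h8 hg.isUnit
  intro i
  rw [Equiv.Perm.mul_apply, Equiv.Perm.mul_apply, Equiv.Perm.mul_apply, Equiv.Perm.mul_apply,
    theta_r, theta_sr, (hg _).1, (hg _).2, theta_r, theta_sr, thetaExp_affine h8 hw,
    thetaExp_affine h8 hw, thetaTwist_congr h8 hw hp]
  exact ⟨rfl, rfl⟩

theorem IsEvenAffine.theta_conj [NeZero n] {h8 : 8 ∣ n} (hg : IsEvenAffine h8 g) :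
    IsEvenAffine h8 (theta h8 * g * theta h8) := by
  obtain ⟨w, a, b, H, hp⟩ := hg
  refine ⟨_, _, _, H.imp (fun H => H.theta_conj h8 hp) (fun H => H.theta_conj h8 hp), ?_⟩
  rw [modFour_thetaExp, modFour_thetaExp, hp]

theorem eq_zero_or_eq_two_of_two_mul (x : ZMod 4) : 2 * x = 0 ∨ 2 * x = 2 := by
  revert x; decide

theorem IsBlockAffine.exists_pow_modFour [NeZero n] (h8 : 8 ∣ n) (hg : IsBlockAffine g v a b)
    (k : ℕ) : ∃ w c d, IsBlockAffine (g ^ k) w c d ∧ 2 * modFour h8 c = k * (2 * modFour h8 a) ∧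
      2 * modFour h8 d = k * (2 * modFour h8 b) := by
  induction k with
  | zero => exact ⟨1, 0, 0, by simpa using isBlockAffine_one, by simp, by simp⟩
  | succ k ih =>
    obtain ⟨w, c, d, h, hc, hd⟩ := ih
    have hw := two_mul_modFour_of_isUnit h8 h.isUnit
    rw [pow_succ]
    refine ⟨_, _, _, h.mul hg, ?_, ?_⟩
    · simp only [map_add, map_mul]; push_cast
      linear_combination modFour h8 a * hw + hc
    · simp only [map_add, map_mul]; push_cast
      linear_combination modFour h8 b * hw + hd

/-- Rotations that preserve the blocks have odd translation parts. -/
theorem IsDihedralPair.two_mul_modFour (hn : 3 ≤ n) [NeZero n] (h8 : 8 ∣ n)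
    (hN : N ∈ classS (DihedralGroup n)) (h : IsDihedralPair n N X T)
    (hX : IsBlockAffine X w a b) : 2 * modFour h8 a = 2 ∧ 2 * modFour h8 b = 2 := by
  have h20 : (2 : ZMod 4) ≠ 0 := by decide
  obtain ⟨s, c, d, hT⟩ := h.exists_isSwapAffine hn hN hX
  have ha : 2 * modFour h8 a = 2 := by
    refine (eq_zero_or_eq_two_of_two_mul _).resolve_left fun h0 => ?_
    obtain ⟨Y, ⟨hY, hY0⟩, -⟩ := hN.1 (r 0) (r 1)
    obtain ⟨k, rfl | rfl⟩ := h.cases Y hY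
    · obtain ⟨_, c', _, hk, hc, -⟩ := hX.exists_pow_modFour h8 k
      rw [(hk 0).1, r.injEq, mul_zero, zero_add] at hY0
      rw [hY0, h0, map_one, mul_zero, mul_one] at hc
      exact h20 hc
    · obtain ⟨_, _, hk⟩ := hX.exists_pow k
      rw [((hT.mul_block hk) 0).1] at hY0
      simp at hY0
  have hb : 2 * modFour h8 b = 2 := by
    refine (eq_zero_or_eq_two_of_two_mul _).resolve_left fun h0 => ?_
    obtain ⟨Y, ⟨hY, hY0⟩, -⟩ := hN.1 (sr 0) (sr 1)
    obtain ⟨k, rfl | rfl⟩ := h.cases Y hY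
    · obtain ⟨_, _, d', hk, -, hd⟩ := hX.exists_pow_modFour h8 k
      rw [(hk 0).2, sr.injEq, mul_zero, zero_add] at hY0
      rw [hY0, h0, map_one, mul_zero, mul_one] at hd
      exact h20 hd
    · obtain ⟨_, _, hk⟩ := hX.exists_pow k
      rw [((hT.mul_block hk) 0).2] at hY0
      simp at hY0
  exact ⟨ha, hb⟩

/-- The members of `𝓢(D_n)` consist of even affine maps. -/
theorem isEvenAffine_of_mem_classS (hn : 3 ≤ n) (h8 : 8 ∣ n) (hN : N ∈ classS (DihedralGroup n))
    (hg : g ∈ N) : IsEvenAffine h8 g := by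
  have : NeZero n := ⟨by omega⟩
  have h20 : (2 : ZMod 4) ≠ 0 := by decide
  obtain ⟨X, T, h, hXT⟩ := exists_isDihedralPair_of_mem_classS hn hN
  suffices IsEvenAffine h8 X ∧ IsEvenAffine h8 T by
    obtain ⟨k, rfl | rfl⟩ := h.cases g hg
    · exact this.1.pow k
    · exact this.2.mul (this.1.pow k)
  rcases hXT with ⟨w, a, b, s, c, d, hw, hX, hT⟩ | ⟨w, a, b, s, c, d, hw, hX, hT⟩
  · constructor
    · refine ⟨w, a, b, Or.inl hX, ?_⟩
      obtain ⟨ha, hb⟩ := h.two_mul_modFour hn h8 hN hX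
      rw [ha, hb]
    · refine ⟨s, c, d, Or.inr hT, ?_⟩
      have hs := two_mul_modFour_of_isUnit h8 hT.isUnit
      have h1 := hT.mul hT
      rw [h.refl_sq] at h1
      have h2 := congrArg (modFour h8) (h1.inj isBlockAffine_one).2.1
      rw [map_add, map_mul, map_zero] at h2
      have h4 : (4 : ZMod 4) = 0 := rfl
      linear_combination -2 * h2 + modFour h8 c * hs + (modFour h8 c) * h4
  · have hX2 := hX.pow_two_mul hw 1
    have hg : 2 * modFour h8 (w * a + b) = 2 * modFour h8 a + 2 * modFour h8 b := by
      rw [map_add, map_mul]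
      linear_combination modFour h8 a * two_mul_modFour_of_isUnit h8 hX.isUnit
    have hg' : 2 * modFour h8 (w * b + a) = 2 * modFour h8 a + 2 * modFour h8 b := by
      rw [map_add, map_mul]
      linear_combination modFour h8 b * two_mul_modFour_of_isUnit h8 hX.isUnit
    -- `X^n = 1` gives `(n/2)(w a + b) = 0`, so `w a + b` is even; it has the parity of `a + b`.
    have hab : 2 * modFour h8 a + 2 * modFour h8 b = 0 := by
      have h1 := hX.pow_two_mul hw (n / 2)
      have e : 2 * (n / 2) = n := by omega
      rw [e, h.rot_pow] at h1
      have h2 := (h1.inj isBlockAffine_one).2.1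
      rcases eq_zero_or_eq_two_of_two_mul (modFour h8 (w * a + b)) with h0 | h0
      · rw [← hg, h0]
      · exfalso
        rw [half_mul_congr h8 (y := 1) (by rw [h0, map_one, mul_one]), mul_one,
          ZMod.natCast_eq_zero_iff] at h2
        have := Nat.le_of_dvd (by omega) h2
        omega
    rw [hab] at hg hg'
    have h4 : (4 : ZMod 4) = 0 := rfl
    refine ⟨⟨w, a, b, Or.inr hX, by linear_combination hab - modFour h8 b * h4⟩,
      s, c, d, Or.inl hT, ?_⟩
    have hs := two_mul_modFour_of_isUnit h8 hT.isUnit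
    -- If `c` were even, `X²` and `T` would preserve parities on `{x^i}`; odd powers of `X` leave
    -- the block, so nothing could map `x^0` to `x^1`.
    have hc : 2 * modFour h8 c = 2 := by
      refine (eq_zero_or_eq_two_of_two_mul _).resolve_left fun h0 => ?_
      obtain ⟨Y, ⟨hY, hY0⟩, -⟩ := hN.1 (r 0) (r 1)
      obtain ⟨k, hk⟩ := h.cases Y hY
      rcases Nat.even_or_odd' k with ⟨m, rfl | rfl⟩
      · have hp := hX.pow_two_mul hw m
        rcases hk with rfl | rfl
        · rw [(hp 0).1, r.injEq] at hY0
          have := congrArg (fun x => 2 * modFour h8 x) hY0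
          simp only [map_add, map_mul, map_one, map_zero, map_natCast] at this hg
          exact h20 (by linear_combination -this + (m : ZMod 4) * hg)
        · rw [((hT.mul hp) 0).1, r.injEq] at hY0
          have := congrArg (fun x => 2 * modFour h8 x) hY0
          simp only [map_add, map_mul, map_one, map_zero, map_natCast] at this hg
          exact h20 (by linear_combination -this + (m : ZMod 4) * modFour h8 s * hg + h0)
      · have hp := (hX.pow_two_mul hw m).mul_swap hX
        rw [← pow_succ] at hp
        rcases hk with rfl | rfl
        · rw [(hp 0).1] at hY0
          simp at hY0
        · rw [((hT.mul_swap hp) 0).1] at hY0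
          simp at hY0
    have hd : 2 * modFour h8 d = 2 := by
      refine (eq_zero_or_eq_two_of_two_mul _).resolve_left fun h0 => ?_
      obtain ⟨Y, ⟨hY, hY0⟩, -⟩ := hN.1 (sr 0) (sr 1)
      obtain ⟨k, hk⟩ := h.cases Y hY
      rcases Nat.even_or_odd' k with ⟨m, rfl | rfl⟩
      · have hp := hX.pow_two_mul hw m
        rcases hk with rfl | rfl
        · rw [(hp 0).2, sr.injEq] at hY0
          have := congrArg (fun x => 2 * modFour h8 x) hY0
          simp only [map_add, map_mul, map_one, map_zero, map_natCast] at this hg'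
          exact h20 (by linear_combination -this + (m : ZMod 4) * hg')
        · rw [((hT.mul hp) 0).2, sr.injEq] at hY0
          have := congrArg (fun x => 2 * modFour h8 x) hY0
          simp only [map_add, map_mul, map_one, map_zero, map_natCast] at this hg'
          exact h20 (by linear_combination -this + (m : ZMod 4) * modFour h8 s * hg' + h0)
      · have hp := (hX.pow_two_mul hw m).mul_swap hX
        rw [← pow_succ] at hp
        rcases hk with rfl | rfl
        · rw [(hp 0).2] at hY0
          simp at hY0
        · rw [((hT.mul_swap hp) 0).2] at hY0
          simp at hY0
    rw [hc, hd]

theorem theta_conj_mem_classS (hn : 3 ≤ n) [NeZero n] (h8 : 8 ∣ n)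
    (hN : N ∈ classS (DihedralGroup n)) :
    conjSubgroup (theta h8) N ∈ classS (DihedralGroup n) := by
  refine ⟨hN.1.conjSubgroup _, nonempty_mulEquiv_conjSubgroup hN.2.1 _, fun x hx => ?_⟩
  have h1 := (isEvenAffine_of_mem_classS hn h8 hN (mem_conjSubgroup.1 hx)).theta_conj
  rw [theta_inv] at h1
  have e : theta h8 * (theta h8 * x * theta h8) * theta h8 =
      (theta h8 * theta h8) * x * (theta h8 * theta h8) := by group
  rw [e, theta_mul_self, one_mul, mul_one] at h1
  exact h1.mem_hol

theorem conjLeftReg_theta_mul_tau_mem_classQ (hn : 3 ≤ n) [NeZero n] (h8 : 8 ∣ n)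
    {u : (ZMod n)ˣ} (hu : u ^ 2 = 1) :
    conjLeftReg (theta h8 * tau n u) ∈ classQ (DihedralGroup n) := by
  refine conjLeftReg_mem_classQ ?_ fun N hN x hx => ?_
  · rw [conjLeftReg_mul]
    exact (theta_conj_mem_classS hn h8 (conjLeftReg_tau_mem_classQ hn hu).1.1).2.2
  · rw [mem_normOf_conjLeftReg, mul_inv_rev, tau_inv hu, theta_inv]
    have := tau_conj_mem_hol hn hu (isEvenAffine_of_mem_classS hn h8 hN hx).theta_conj.mem_hol
    simpa [mul_assoc] using this

/-- The members of `𝓠(D_n)` are the groups `τ_u λ τ_u⁻¹` and, for `8 ∣ n`, their conjugates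
by `θ`. -/
theorem exists_eq_of_mem_classQ (hn : 3 ≤ n) [NeZero n] (hn4 : n ≠ 4)
    (hM : M ∈ classQ (DihedralGroup n)) :
    (∃ u : (ZMod n)ˣ, u ^ 2 = 1 ∧ M = conjLeftReg (tau n u)) ∨
      ∃ (h8 : 8 ∣ n) (u : (ZMod n)ˣ), u ^ 2 = 1 ∧ M = conjLeftReg (theta h8 * tau n u) := by
  refine (cases_of_mem_classQ hn hn4 hM).imp_right ?_
  rintro ⟨h8, X, T, a, b, h, hX⟩
  refine ⟨h8, ?_⟩
  have hw : modFour h8 (1 + ((n / 2 : ℕ) : ZMod n)) = 1 := by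
    rw [map_add, modFour_half, map_one, add_zero]
  obtain ⟨ha, hb⟩ := h.two_mul_modFour hn h8 hM.1.1 hX
  have hX' := hX.theta_conj h8 (ha.trans hb.symm)
  -- The rotation `X` has odd translations, so conjugation by `θ` adds a second `n/2` to its
  -- multiplier, which becomes `1`.
  rw [thetaTwist_of_odd h8 hw ha, add_assoc, half_add_half h8, add_zero] at hX'
  have hpair := h.conjSubgroup (theta h8)
  rw [theta_inv] at hpair
  obtain ⟨u, hu, e⟩ := eq_conjLeftReg_tau hn (theta_conj_mem_classS hn h8 hM.1.1) hpair hX'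
  refine ⟨u, hu, ?_⟩
  rw [conjLeftReg_mul, ← e, ← conjSubgroup_mul, theta_mul_self, conjSubgroup_one]

end Theta

/-! ### Sets of representatives for `𝓠(D_n)`. -/

section Parameterization

open DihedralGroup

variable {n : ℕ}

/-- `τ` as a homomorphism. -/
def tauHom (n : ℕ) : (ZMod n)ˣ →* Equiv.Perm (DihedralGroup n) where
  toFun := tau n
  map_one' := by
    ext1 y
    rcases y with i | i
    · rfl
    · exact congrArg sr (one_mul i)
  map_mul' u v := by
    ext1 y
    rcases y with i | i
    · rfl
    · exact congrArg sr (mul_assoc (u : ZMod n) v i)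

/-- `Υ_n` as a subgroup. -/
def upsilonSubgroup (n : ℕ) : Subgroup (ZMod n)ˣ := (powMonoidHom 2).ker

theorem mem_upsilonSubgroup {u : (ZMod n)ˣ} : u ∈ upsilonSubgroup n ↔ u ^ 2 = 1 := Iff.rfl

theorem isElementaryAbelianTwo_map_tauHom {S : Subgroup (ZMod n)ˣ} (hS : S ≤ upsilonSubgroup n) :
    IsElementaryAbelianTwo (S.map (tauHom n)) := by
  constructor
  · rintro _ ⟨u, -, rfl⟩ _ ⟨v, -, rfl⟩
    rw [← map_mul, mul_comm, map_mul]
  · rintro _ ⟨u, hu, rfl⟩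
    rw [← map_pow, mem_upsilonSubgroup.1 (hS hu), map_one]

theorem tauSet_parameterizes (hn : 3 ≤ n) :
    Parameterizes (tauSet n) (conjLeftReg '' tauSet n) := by
  refine Set.InjOn.bijOn_image ?_
  rintro _ ⟨u, hu, rfl⟩ _ ⟨v, hv, rfl⟩ h
  rw [tau_injOn hn hu h]

theorem tauSet_parameterizes_classQ (hn : 3 ≤ n) (hn4 : n ≠ 4) (h8 : ¬ 8 ∣ n) :
    Parameterizes (tauSet n) (classQ (DihedralGroup n)) := by
  have : NeZero n := ⟨by omega⟩
  have : conjLeftReg '' tauSet n = classQ (DihedralGroup n) := by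
    ext M
    constructor
    · rintro ⟨_, ⟨u, hu, rfl⟩, rfl⟩
      exact conjLeftReg_tau_mem_classQ hn hu
    · intro hM
      rcases exists_eq_of_mem_classQ hn hn4 hM with ⟨u, hu, rfl⟩ | ⟨h, -⟩
      · exact ⟨_, ⟨u, hu, rfl⟩, rfl⟩
      · exact absurd h h8
  rw [← this]
  exact tauSet_parameterizes hn

theorem conjLeftReg_theta_mul_tau_ne (hn : 3 ≤ n) [NeZero n] (h8 : 8 ∣ n) {u v : (ZMod n)ˣ}
    (hv : v ^ 2 = 1) : conjLeftReg (theta h8 * tau n u) ≠ conjLeftReg (tau n v) := by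
  intro h
  have h1 := conjLeftReg_eq_conjLeftReg_iff.1 h.symm
  rw [tau_inv hv] at h1
  have hr : ∀ i, (tau n v * (theta h8 * tau n u)) (r i) = r (thetaExp n i) := fun i => rfl
  rcases isBlockAffine_or_isSwapAffine_of_mem_hol hn h1 with ⟨w, a, b, H⟩ | ⟨w, a, b, H⟩
  · have e0 := (H 0).1
    have e1 := (H 1).1
    have e2 := (H 2).1
    rw [hr, r.injEq, thetaExp_eq h8] at e0 e1 e2
    simp only [map_zero, map_one, map_ofNat] at e0 e1 e2
    have b0 : (thetaBit 0 : ZMod n) = 0 := if_neg (by decide)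
    have b1 : (thetaBit 1 : ZMod n) = 1 := if_pos (by decide)
    have b2 : (thetaBit 2 : ZMod n) = 1 := if_pos (by decide)
    rw [b0] at e0
    rw [b1] at e1
    rw [b2] at e2
    -- An affine map has zero second difference, but `θ` sends `0, 1, 2` to `0, 1 + n/2, 2 + n/2`.
    have h0 : ((n / 2 : ℕ) : ZMod n) = 0 := by linear_combination 2 * e1 - e2 - e0
    rw [ZMod.natCast_eq_zero_iff] at h0
    have := Nat.le_of_dvd (by omega) h0
    omega
  · have e0 := (H 0).1
    rw [hr] at e0
    cases e0

/-- If `A` parameterizes the conjugates `τ_u λ τ_u⁻¹` then `A ∪ θ A` parameterizes `𝓠(D_n)`. -/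
theorem Parameterizes.union_theta (hn : 3 ≤ n) [NeZero n] (h8 : 8 ∣ n)
    {A : Set (Equiv.Perm (DihedralGroup n))}
    (hA : Parameterizes A (conjLeftReg '' tauSet n)) :
    Parameterizes (A ∪ (fun σ => theta h8 * σ) '' A) (classQ (DihedralGroup n)) := by
  have hA' : ∀ a ∈ A, ∃ u : (ZMod n)ˣ, u ^ 2 = 1 ∧ conjLeftReg a = conjLeftReg (tau n u) := by
    intro a ha
    obtain ⟨_, ⟨u, hu, rfl⟩, e⟩ := hA.mapsTo ha
    exact ⟨u, hu, e.symm⟩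
  have hne : ∀ a ∈ A, ∀ b ∈ A, conjLeftReg (theta h8 * a) ≠ conjLeftReg b := by
    intro a ha b hb e
    obtain ⟨u, hu, eu⟩ := hA' a ha
    obtain ⟨v, hv, ev⟩ := hA' b hb
    rw [conjLeftReg_mul, eu, ev, ← conjLeftReg_mul] at e
    exact conjLeftReg_theta_mul_tau_ne hn h8 hv e
  refine ⟨?_, ?_, ?_⟩
  · rintro _ (ha | ⟨a, ha, rfl⟩)
    · obtain ⟨u, hu, e⟩ := hA' _ ha
      rw [e]
      exact conjLeftReg_tau_mem_classQ hn hu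
    · obtain ⟨u, hu, e⟩ := hA' _ ha
      simp only []
      rw [conjLeftReg_mul, e, ← conjLeftReg_mul]
      exact conjLeftReg_theta_mul_tau_mem_classQ hn h8 hu
  · rintro _ (ha | ⟨a, ha, rfl⟩) _ (hb | ⟨b, hb, rfl⟩) e
    · exact hA.injOn ha hb e
    · exact (hne _ hb _ ha e.symm).elim
    · exact (hne _ ha _ hb e).elim
    · simp only [conjLeftReg_mul] at e
      rw [hA.injOn ha hb (conjSubgroup_injective _ e)]
  · intro M hM
    rcases exists_eq_of_mem_classQ hn (by rintro rfl; omega) hM with ⟨u, hu, rfl⟩ | ⟨h8', u, hu, rfl⟩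
    · obtain ⟨a, ha, e⟩ := hA.surjOn ⟨_, ⟨u, hu, rfl⟩, rfl⟩
      exact ⟨a, Or.inl ha, e⟩
    · obtain ⟨a, ha, e⟩ := hA.surjOn ⟨_, ⟨u, hu, rfl⟩, rfl⟩
      refine ⟨theta h8 * a, Or.inr ⟨a, ha, rfl⟩, ?_⟩
      rw [conjLeftReg_mul, e, ← conjLeftReg_mul]

/-! ### Representatives that commute with `θ`. -/

/-- The reflection `x ^ i ↦ x ^ (-1 - i)` of the block `{x ^ i}` that fixes `{t x ^ i}`. -/
def rotationReflection (n : ℕ) : Equiv.Perm (DihedralGroup n) :=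
  Function.Involutive.toPerm
    (fun
      | .r i => .r (-1 - i)
      | .sr i => .sr i)
    (by rintro (i | i) <;> simp)

theorem rotationReflection_mul_self :
    rotationReflection n * rotationReflection n = 1 := by
  ext1 y
  rcases y with i | i
  · change r (-1 - (-1 - i)) = r i
    congr 1; ring
  · rfl

theorem rotationReflection_mul_tau (u : (ZMod n)ˣ) :
    rotationReflection n * tau n u = tau n u * rotationReflection n := by
  ext1 y
  rcases y with i | i <;> rfl

/-- The quotient `τ_{-u} ρ τ_u`, with `ρ = rotationReflection n`, is affine with multiplier `-1` on
both blocks, hence in the holomorph. -/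
theorem conjLeftReg_rotationReflection_mul_tau (hn : 3 ≤ n) {u : (ZMod n)ˣ} (hu : u ^ 2 = 1) :
    conjLeftReg (rotationReflection n * tau n u) = conjLeftReg (tau n (-u)) := by
  have : NeZero n := ⟨by omega⟩
  symm
  have hu' : (u : ZMod n) * u = 1 := by rw [← Units.val_mul, ← sq, hu, Units.val_one]
  rw [conjLeftReg_eq_conjLeftReg_iff, tau_inv (by rw [neg_sq, hu])]
  refine IsBlockAffine.mem_hol (v := -1) (a := -1) (b := 0) fun i => ⟨?_, ?_⟩
  · change r (-1 - i) = _
    congr 1; ring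
  · change sr (((-u : (ZMod n)ˣ) : ZMod n) * ((u : ZMod n) * i)) = _
    congr 1
    rw [Units.val_neg]
    linear_combination (-i) * hu'

/-- The `u ∈ Υ_n` with `u ≡ 1` modulo `4`. -/
def upsilonOne (h8 : 8 ∣ n) : Subgroup (ZMod n)ˣ :=
  upsilonSubgroup n ⊓ (Units.map (modFour h8 : ZMod n →* ZMod 4)).ker

theorem mem_upsilonOne {h8 : 8 ∣ n} {u : (ZMod n)ˣ} :
    u ∈ upsilonOne h8 ↔ u ^ 2 = 1 ∧ modFour h8 u = 1 := by
  rw [upsilonOne, Subgroup.mem_inf, mem_upsilonSubgroup, MonoidHom.mem_ker]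
  exact and_congr Iff.rfl Units.ext_iff

theorem rotationReflection_comm (h8 : 8 ∣ n) :
    ∀ p ∈ (upsilonOne h8).map (tauHom n),
      rotationReflection n * p = p * rotationReflection n := by
  rintro _ ⟨u, -, rfl⟩
  exact rotationReflection_mul_tau u

/-- An elementary abelian group that parameterizes the conjugates `τ_u λ τ_u⁻¹` and commutes
with `θ`. -/
def thetaCentralizing (h8 : 8 ∣ n) : Subgroup (Equiv.Perm (DihedralGroup n)) :=
  adjoinInvolution ((upsilonOne h8).map (tauHom n)) (rotationReflection n)
    rotationReflection_mul_self (rotationReflection_comm h8)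

theorem mem_thetaCentralizing {h8 : 8 ∣ n} {p : Equiv.Perm (DihedralGroup n)} :
    p ∈ thetaCentralizing h8 ↔ ∃ u ∈ upsilonOne h8,
      p = tau n u ∨ p = rotationReflection n * tau n u := by
  constructor
  · rintro (⟨u, hu, rfl⟩ | ⟨_, ⟨u, hu, rfl⟩, rfl⟩)
    exacts [⟨u, hu, Or.inl rfl⟩, ⟨u, hu, Or.inr rfl⟩]
  · rintro ⟨u, hu, rfl | rfl⟩
    exacts [Or.inl ⟨u, hu, rfl⟩, Or.inr ⟨_, ⟨u, hu, rfl⟩, rfl⟩]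

theorem isElementaryAbelianTwo_thetaCentralizing (h8 : 8 ∣ n) :
    IsElementaryAbelianTwo (thetaCentralizing h8) :=
  (isElementaryAbelianTwo_map_tauHom inf_le_left).adjoinInvolution _ _

theorem theta_comm [NeZero n] (h8 : 8 ∣ n) :
    ∀ p ∈ thetaCentralizing h8, theta h8 * p = p * theta h8 := by
  have h1 : ∀ u ∈ upsilonOne h8, theta h8 * tau n u = tau n u * theta h8 := by
    intro u hu
    ext1 y
    rcases y with i | i
    · rfl
    · exact congrArg sr (thetaExp_mul h8 (mem_upsilonOne.1 hu).2 i)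
  have h2 : theta h8 * rotationReflection n = rotationReflection n * theta h8 := by
    ext1 y
    rcases y with i | i
    · exact congrArg r (thetaExp_reflect h8 i)
    · rfl
  intro p hp
  obtain ⟨u, hu, rfl | rfl⟩ := mem_thetaCentralizing.1 hp
  · exact h1 u hu
  · rw [← mul_assoc, h2, mul_assoc, h1 u hu, mul_assoc]

theorem thetaCentralizing_parameterizes (hn : 3 ≤ n) (h8 : 8 ∣ n) :
    Parameterizes (thetaCentralizing h8 : Set (Equiv.Perm (DihedralGroup n)))
      (conjLeftReg '' tauSet n) := by
  have hneg : ∀ {u : (ZMod n)ˣ}, u ^ 2 = 1 → (-u) ^ 2 = 1 := fun hu => by rw [neg_sq, hu]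
  have hne : ∀ u ∈ upsilonOne h8, ∀ v ∈ upsilonOne h8, -u ≠ v := by
    rintro u hu v hv rfl
    have h1 := (mem_upsilonOne.1 hv).2
    rw [Units.val_neg, map_neg, (mem_upsilonOne.1 hu).2] at h1
    exact absurd h1 (by decide)
  refine ⟨?_, ?_, ?_⟩
  · intro p hp
    obtain ⟨u, hu, rfl | rfl⟩ := mem_thetaCentralizing.1 hp
    · exact ⟨_, ⟨u, hu.1, rfl⟩, rfl⟩
    · exact ⟨_, ⟨-u, hneg hu.1, rfl⟩, (conjLeftReg_rotationReflection_mul_tau hn hu.1).symm⟩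
  · intro p hp q hq e
    obtain ⟨u, hu, rfl | rfl⟩ := mem_thetaCentralizing.1 hp <;>
      obtain ⟨v, hv, rfl | rfl⟩ := mem_thetaCentralizing.1 hq
    · rw [tau_injOn hn hu.1 e]
    · rw [conjLeftReg_rotationReflection_mul_tau hn hv.1] at e
      exact (hne v hv u hu (tau_injOn hn hu.1 e).symm).elim
    · rw [conjLeftReg_rotationReflection_mul_tau hn hu.1] at e
      exact (hne u hu v hv (tau_injOn hn (hneg hu.1) e)).elim
    · rw [conjLeftReg_rotationReflection_mul_tau hn hu.1,
        conjLeftReg_rotationReflection_mul_tau hn hv.1] at e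
      rw [neg_injective (tau_injOn hn (hneg hu.1) e)]
  · rintro _ ⟨_, ⟨u, hu, rfl⟩, rfl⟩
    -- A unit is `±1` modulo `4`; the sign decides whether `τ_u` or `ρ τ_{-u}` represents its
    -- conjugate.
    have hu4 : modFour h8 u = 1 ∨ modFour h8 u = -1 := by
      have := two_mul_modFour_of_isUnit h8 u.isUnit
      revert this
      generalize modFour h8 u = x
      revert x; decide
    rcases hu4 with h | h
    · exact ⟨_, mem_thetaCentralizing.2 ⟨u, mem_upsilonOne.2 ⟨hu, h⟩, Or.inl rfl⟩, rfl⟩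
    · refine ⟨_, mem_thetaCentralizing.2 ⟨-u, mem_upsilonOne.2 ⟨hneg hu, ?_⟩, Or.inr rfl⟩, ?_⟩
      · rw [Units.val_neg, map_neg, h, neg_neg]
      · rw [conjLeftReg_rotationReflection_mul_tau hn (hneg hu), neg_neg]

theorem theta_notMem_thetaCentralizing (hn : 3 ≤ n) [NeZero n] (h8 : 8 ∣ n) :
    theta h8 ∉ thetaCentralizing h8 := by
  intro h
  obtain ⟨_, ⟨u, hu, rfl⟩, e⟩ := (thetaCentralizing_parameterizes hn h8).mapsTo h
  refine conjLeftReg_theta_mul_tau_ne hn h8 (u := 1) hu ?_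
  rw [e]
  exact congrArg conjLeftReg ((congrArg _ (tauHom n).map_one).trans (mul_one _))

theorem ncard_tauSet_union (hn : 3 ≤ n) [NeZero n] (h8 : 8 ∣ n) :
    (tauSet n ∪ (fun σ => theta h8 * σ) '' tauSet n).ncard = 2 * (tauSet n).ncard := by
  rw [Set.ncard_union_eq, Set.ncard_image_of_injective _ (mul_right_injective _), two_mul]
  rw [Set.disjoint_left]
  rintro _ ⟨u, hu, rfl⟩ ⟨_, ⟨v, -, rfl⟩, e⟩
  exact conjLeftReg_theta_mul_tau_ne hn h8 hu (congrArg conjLeftReg e)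

end Parameterization

theorem mainTheorem7 (n : ℕ) (hn : 3 ≤ n) (hn4 : n ≠ 4) :
    ∃ P : Subgroup (Equiv.Perm (DihedralGroup n)),
      IsElementaryAbelianTwo P ∧
      Parameterizes (P : Set (Equiv.Perm (DihedralGroup n))) (classQ (DihedralGroup n)) ∧
      (¬ 8 ∣ n → (P : Set (Equiv.Perm (DihedralGroup n))) = tauSet n) ∧
      (8 ∣ n → ∃ θ : Equiv.Perm (DihedralGroup n),
        (∀ g, θ g = thetaFun n g) ∧ orderOf θ = 2 ∧
        Parameterizes (tauSet n ∪ (fun σ => θ * σ) '' tauSet n) (classQ (DihedralGroup n)) ∧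
        Nat.card P = 2 * (tauSet n).ncard ∧
        ∃ P₀ : Subgroup (Equiv.Perm (DihedralGroup n)),
          Parameterizes (P₀ : Set (Equiv.Perm (DihedralGroup n))) (conjLeftReg '' tauSet n) ∧
          θ ∉ P₀ ∧
          (P : Set (Equiv.Perm (DihedralGroup n))) =
            (P₀ : Set (Equiv.Perm (DihedralGroup n))) ∪
              (fun σ => θ * σ) '' (P₀ : Set (Equiv.Perm (DihedralGroup n)))) ∧
      ∃ K : Subgroup (Equiv.Perm (DihedralGroup n)),
        (∀ A : Set (Equiv.Perm (DihedralGroup n)),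
          Parameterizes A (classQ (DihedralGroup n)) →
            holCosets A = (K : Set (Equiv.Perm (DihedralGroup n)))) ∧
        IsZappaSzep K P (hol (DihedralGroup n)) := by
  have : NeZero n := ⟨by omega⟩
  by_cases h8 : 8 ∣ n
  · have hP := (thetaCentralizing_parameterizes hn h8).union_theta hn h8
    have hT := (tauSet_parameterizes hn).union_theta hn h8
    refine ⟨adjoinInvolution (thetaCentralizing h8) (theta h8) (theta_mul_self h8) (theta_comm h8),
      (isElementaryAbelianTwo_thetaCentralizing h8).adjoinInvolution _ _, hP,
      fun h => absurd h8 h, fun _ => ⟨theta h8, fun g => rfl, ?_, hT, ?_, thetaCentralizing h8,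
        thetaCentralizing_parameterizes hn h8, theta_notMem_thetaCentralizing hn h8, rfl⟩,
      exists_isZappaSzep hP⟩
    · refine orderOf_eq_prime (by rw [sq, theta_mul_self]) fun h => ?_
      exact theta_notMem_thetaCentralizing hn h8 (h ▸ one_mem _)
    -- `P` and `M_n ∪ θ M_n` are both in bijection with `𝓠(D_n)`.
    · rw [← ncard_tauSet_union hn h8, ← hT.injOn.ncard_image, hT.image_eq, ← hP.image_eq,
        hP.injOn.ncard_image]
      rfl
  · have e : ((upsilonSubgroup n).map (tauHom n) : Set (Equiv.Perm (DihedralGroup n))) = tauSet n :=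
      rfl
    have hP := tauSet_parameterizes_classQ hn hn4 h8
    rw [← e] at hP
    exact ⟨(upsilonSubgroup n).map (tauHom n), isElementaryAbelianTwo_map_tauHom le_rfl, hP,
      fun _ => e, fun h => absurd h h8, exists_isZappaSzep hP⟩
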